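/- Let $k$ be a field and let $H$ be a Hopf algebra over $k$ with antipode $S$, coproduct $h\mapsto h_1\otimes h_2$ and counit $\varepsilon$. Suppose that $H$ has a left-right integral, that is, a nonzero linear functional $\int:H\to k$ with $a_1\int(a_2)=\int(a)\,1=\int(a_1)\,a_2$ for all $a\in H$. Comodules are right $H$-comodules, with coaction written $v\mapsto v_0\otimes v_1$. The dual $M^*$ of a finite-dimensional comodule $M$ carries the coaction determined by $\varphi_0(x)\varphi_1=\varphi(x_0)S(x_1)$ for $x\in M$, $\varphi\in M^*$. For a comodule $V$, $v\in V$ and $h\in H$ put $h\circ v:=v_0\int(hS(v_1))$. Let $V$ be a simple comodule. Then $V$ is finite-dimensional and the following hold. 1. The comodule $V^\bullet$ is well defined: some $b\in V$ generates $V$, i.e. satisfies $H\circ b=V$, and there is a unique comodule structure $\delta^\bullet$ on the vector space $V$ such that $\delta^\bullet(h\circ b)=(h_1\circ b)\otimes h_2$ for every such $b$ and all $h\in H$. The comodule $V^\bullet:=(V,\delta^\bullet)$ satisfies $V^\bullet\cong V^{**}$. 2. Suppose moreover that $H$ is coquasitriangular, i.e. there is a bilinear form $r$ on $H$, invertible for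 the convolution product of functionals on $H\otimes H$, with $r(ab,c)=r(a,c_1)r(b,c_2)$, $r(a,bc)=r(a_1,c)r(a_2,b)$ and $r(a_1,b_1)a_2b_2=b_1a_1r(a_2,b_2)$ for all $a,b,c\in H$. Then $V^\bullet\cong V$. Moreover, every injective hull ${\cal J}(V)$ of $V$ is finite-dimensional, ${\cal J}(V)^*$ is an injective hull of $V^*$, and ${\cal J}(V^*)\cong{\cal J}(V)^*$ for every injective hull ${\cal J}(V^*)$ of $V^*$. Here an injective hull of $M$ is an injective comodule $J$ together with a comodule morphism $M\to J$ that restricts to an isomorphism from the socle of $M$ (the sum of its simple subcomodules) onto the socle of $J$. -/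

import Mathlib

open scoped TensorProduct

universe u v w x y

/-- A right comodule structure on the `k`-vector space `V` over the coalgebra `H`: a coassociative
and counital linear map `V → V ⊗ H`, written `v ↦ v₀ ⊗ v₁`. -/
@[ext]
structure RightComodule (k : Type u) (H : Type v) (V : Type w) [Field k]
    [AddCommGroup H] [Module k H] [Coalgebra k H] [AddCommGroup V] [Module k V] where
  /-- The coaction. -/
  coact : V →ₗ[k] V ⊗[k] H
  coassoc : (TensorProduct.assoc k V H H).toLinearMap ∘ₗ coact.rTensor H ∘ₗ coact =
    (Coalgebra.comul (R := k) (A := H)).lTensor V ∘ₗ coact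
  counit_coact : (Coalgebra.counit (R := k) (A := H)).lTensor V ∘ₗ coact =
    (TensorProduct.mk k V k).flip 1

namespace RightComodule

section Coalgebra

variable {k : Type u} {H : Type v} [Field k] [AddCommGroup H] [Module k H] [Coalgebra k H]
  {V : Type w} [AddCommGroup V] [Module k V] {W : Type x} [AddCommGroup W] [Module k W]

/-- `f` is a morphism of right comodules: `f(v)₀ ⊗ f(v)₁ = f(v₀) ⊗ v₁`. -/
def IsHom (ρ : RightComodule k H V) (σ : RightComodule k H W) (f : V →ₗ[k] W) : Prop :=
  σ.coact ∘ₗ f = f.rTensor H ∘ₗ ρ.coact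

/-- The right comodules `(V, ρ)` and `(W, σ)` are isomorphic. -/
def Iso (ρ : RightComodule k H V) (σ : RightComodule k H W) : Prop :=
  ∃ e : V ≃ₗ[k] W, IsHom ρ σ e.toLinearMap

/-- The subspace `U` is a subcomodule: the coaction sends `U` into `U ⊗ H ⊆ V ⊗ H`. -/
def IsSubcomodule (ρ : RightComodule k H V) (U : Submodule k V) : Prop :=
  ∀ v ∈ U, ρ.coact v ∈ LinearMap.range (U.subtype.rTensor H)

/-- The subspace `U` is a simple subcomodule: a nonzero subcomodule which contains no other
subcomodule than `0` and itself. -/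
def IsSimpleSubcomodule (ρ : RightComodule k H V) (U : Submodule k V) : Prop :=
  ρ.IsSubcomodule U ∧ U ≠ ⊥ ∧ ∀ U' ≤ U, ρ.IsSubcomodule U' → U' = ⊥ ∨ U' = U

/-- The comodule is simple: it is nonzero, and its only subcomodules are `0` and itself. -/
def IsSimple (ρ : RightComodule k H V) : Prop :=
  Nontrivial V ∧ ∀ U : Submodule k V, ρ.IsSubcomodule U → U = ⊥ ∨ U = ⊤

/-- The socle: the sum of all simple subcomodules. -/
def socle (ρ : RightComodule k H V) : Submodule k V :=
  sSup {U | ρ.IsSimpleSubcomodule U}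

/-- `(V, ρ)` is an injective object among right `H`-comodules: comodule morphisms into `V` extend
along injective comodule morphisms. The test objects live in a universe which contains
`k`, `H`, `V` and hence also every comodule `V ⊗ H`. -/
def IsInjective (ρ : RightComodule k H V) : Prop :=
  ∀ (X Y : Type (max u v w)) [AddCommGroup X] [Module k X] [AddCommGroup Y] [Module k Y]
    (ξ : RightComodule k H X) (η : RightComodule k H Y) (i : X →ₗ[k] Y) (f : X →ₗ[k] V),
    IsHom ξ η i → Function.Injective i → IsHom ξ ρ f →
      ∃ g : Y →ₗ[k] V, IsHom η ρ g ∧ g ∘ₗ i = f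

/-- `(W, σ)` is an injective hull of `(V, ρ)`: it is injective, and there is a comodule morphism
`V → W` which restricts to an isomorphism from the socle of `V` onto the socle of `W`. -/
def IsInjectiveHull (ρ : RightComodule k H V) (σ : RightComodule k H W) : Prop :=
  σ.IsInjective ∧ ∃ j : V →ₗ[k] W, IsHom ρ σ j ∧
    Set.BijOn j (ρ.socle : Set V) (σ.socle : Set W)

end Coalgebra

end RightComodule

section Antipode

open Coalgebra HopfAlgebra WithConv LinearMap

variable {k : Type u} {H : Type v} [Field k] [Ring H] [HopfAlgebra k H]

/-- The antipode reverses the coproduct: `S(h)₁ ⊗ S(h)₂ = S(h₂) ⊗ S(h₁)`. -/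
theorem comul_comp_antipode_eq :
    (comul (R := k) (A := H)) ∘ₗ antipode k =
      TensorProduct.map (antipode k) (antipode k) ∘ₗ
        (TensorProduct.comm k H H).toLinearMap ∘ₗ comul := by
  let l : H →ₐ[k] H ⊗[k] H := Algebra.TensorProduct.includeLeft
  let r : H →ₐ[k] H ⊗[k] H := Algebra.TensorProduct.includeRight
  have hd : toConv (comul (R := k) (A := H)) =
      toConv l.toLinearMap * toConv r.toLinearMap := by
    ext a
    rw [(ℛ k a).convMul_apply]
    simp [l, r, (ℛ k a).eq]
  have hg : toConv (TensorProduct.map (antipode k) (antipode k) ∘ₗ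
        (TensorProduct.comm k H H).toLinearMap ∘ₗ (comul (R := k) (A := H))) =
      toConv (r.toLinearMap ∘ₗ antipode k) * toConv (l.toLinearMap ∘ₗ antipode k) := by
    ext a
    rw [(ℛ k a).convMul_apply]
    simp [l, r, ← (ℛ k a).eq]
  have hl : toConv (l.toLinearMap ∘ₗ antipode k) * toConv l.toLinearMap = 1 := by
    have h := algHom_comp_convMul_distrib (R := k) (C := H) l (toConv (antipode k)) (toConv id)
    rw [antipode_mul_id] at h
    apply WithConv.ext
    refine h.symm.trans ?_
    ext a
    simp [LinearMap.convOne_def]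
  have hr : toConv (r.toLinearMap ∘ₗ antipode k) * toConv r.toLinearMap = 1 := by
    have h := algHom_comp_convMul_distrib (R := k) (C := H) r (toConv (antipode k)) (toConv id)
    rw [antipode_mul_id] at h
    apply WithConv.ext
    refine h.symm.trans ?_
    ext a
    simp [LinearMap.convOne_def]
  have hleft : toConv (TensorProduct.map (antipode k) (antipode k) ∘ₗ
        (TensorProduct.comm k H H).toLinearMap ∘ₗ (comul (R := k) (A := H))) *
      toConv (comul (R := k) (A := H)) = 1 := by
    rw [hg, hd, mul_assoc, ← mul_assoc (toConv (l.toLinearMap ∘ₗ antipode k)), hl, one_mul, hr]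
  exact (toConv_injective (left_inv_eq_right_inv hleft comul_right_inv)).symm

end Antipode

namespace RightComodule

section Hopf

open Coalgebra HopfAlgebra

variable {k : Type u} {H : Type v} [Field k] [Ring H] [HopfAlgebra k H]
  {V : Type w} [AddCommGroup V] [Module k V]

/-- The linear map sending `φ ∈ V*` to `v ↦ φ(v₀) S(v₁)`. -/
noncomputable def dualAux (ρ : RightComodule k H V) : Module.Dual k V →ₗ[k] (V →ₗ[k] H) where
  toFun φ := (TensorProduct.lid k H).toLinearMap ∘ₗ TensorProduct.map φ (antipode k) ∘ₗ ρ.coact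
  map_add' φ ψ := by ext; simp [TensorProduct.map_add_left]
  map_smul' c φ := by ext; simp [TensorProduct.map_smul_left]

/-- The coaction on `V*` for finite-dimensional `V`: `φ₀ ⊗ φ₁` is the element of `V* ⊗ H`
determined by `φ₀(v) φ₁ = φ(v₀) S(v₁)` for all `v`. -/
noncomputable def dualCoact (ρ : RightComodule k H V) [FiniteDimensional k V] :
    Module.Dual k V →ₗ[k] Module.Dual k V ⊗[k] H :=
  (dualTensorHomEquiv k V H).symm.toLinearMap ∘ₗ ρ.dualAux

theorem dualTensorHom_dualCoact (ρ : RightComodule k H V) [FiniteDimensional k V]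
    (φ : Module.Dual k V) :
    dualTensorHom k V H (ρ.dualCoact φ) =
      (TensorProduct.lid k H).toLinearMap ∘ₗ TensorProduct.map φ (antipode k) ∘ₗ ρ.coact :=
  (dualTensorHomEquiv k V H).apply_symm_apply (ρ.dualAux φ)

theorem dualTensorHom_assoc_tmul (s : Module.Dual k V ⊗[k] H) (h : H) (v : V) :
    dualTensorHom k V (H ⊗[k] H) (TensorProduct.assoc k _ _ _ (s ⊗ₜ[k] h)) v =
      dualTensorHom k V H s v ⊗ₜ[k] h := by
  induction s with
  | zero => simp
  | add a b ha hb => simp [TensorProduct.add_tmul, ha, hb]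
  | tmul φ g => simp [TensorProduct.smul_tmul']

theorem dualTensorHom_assoc_rTensor (ρ : RightComodule k H V) [FiniteDimensional k V]
    (t : Module.Dual k V ⊗[k] H) :
    dualTensorHom k V (H ⊗[k] H) (TensorProduct.assoc k _ _ _ (ρ.dualCoact.rTensor H t)) =
      (TensorProduct.comm k H H).toLinearMap ∘ₗ
        TensorProduct.map (dualTensorHom k V H t) (antipode k) ∘ₗ ρ.coact := by
  induction t with
  | zero => simp
  | add a b ha hb => simp [ha, hb, TensorProduct.map_add_left, LinearMap.add_comp,
      LinearMap.comp_add]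
  | tmul ψ h =>
    ext v
    rw [LinearMap.rTensor_tmul, dualTensorHom_assoc_tmul, dualTensorHom_dualCoact]
    simp only [LinearMap.comp_apply]
    generalize ρ.coact v = z
    induction z with
    | zero => simp
    | add a b ha hb => simpa [TensorProduct.add_tmul] using congr($ha + $hb)
    | tmul v g => simp [TensorProduct.smul_tmul']

/-- The dual `V*` of a finite-dimensional right comodule `V`, with the coaction
`φ₀(v) φ₁ = φ(v₀) S(v₁)`. -/
noncomputable def dual (ρ : RightComodule k H V) [FiniteDimensional k V] :
    RightComodule k H (Module.Dual k V) where
  coact := ρ.dualCoact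
  coassoc := by
    apply LinearMap.ext
    intro φ
    apply (dualTensorHom_bijective (R := k) (M := V) (N := H ⊗[k] H)).1
    simp only [LinearMap.comp_apply, LinearEquiv.coe_coe]
    rw [dualTensorHom_assoc_rTensor, dualTensorHom_dualCoact]
    have h1 := congr($(dualTensorHom_comp_lTensor (R := k) (M := V)
      (comul (R := k) (A := H))) (ρ.dualCoact φ))
    simp only [LinearMap.comp_apply, dualTensorHom_dualCoact] at h1
    rw [h1]
    ext v
    have h2 := congr($(ρ.coassoc) v)
    simp only [LinearMap.comp_apply, LinearEquiv.coe_coe, LinearMap.compRight_apply] at h2 ⊢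
    have h3 : ∀ z : V ⊗[k] H, comul (R := k) (TensorProduct.lid k H
        (TensorProduct.map φ (antipode k) z)) =
        TensorProduct.lid k _ (TensorProduct.map φ (TensorProduct.map (antipode k) (antipode k) ∘ₗ
        (TensorProduct.comm k H H).toLinearMap) ((comul (R := k) (A := H)).lTensor V z)) := by
      intro z
      induction z with
      | zero => simp
      | add a b ha hb => simp [ha, hb]
      | tmul v g =>
        have := congr($(comul_comp_antipode_eq (k := k) (H := H)) g)
        simp only [LinearMap.comp_apply, LinearEquiv.coe_coe] at this
        simp [this]
    have h4 : ∀ z : V ⊗[k] H, TensorProduct.comm k H H (TensorProduct.map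
        ((TensorProduct.lid k H).toLinearMap ∘ₗ TensorProduct.map φ (antipode k) ∘ₗ ρ.coact)
          (antipode k) z) =
        TensorProduct.lid k _ (TensorProduct.map φ (TensorProduct.map (antipode k) (antipode k) ∘ₗ
        (TensorProduct.comm k H H).toLinearMap)
          (TensorProduct.assoc k V H H (ρ.coact.rTensor H z))) := by
      intro z
      induction z with
      | zero => simp
      | add a b ha hb => simp [ha, hb]
      | tmul v g =>
        simp only [TensorProduct.map_tmul, LinearMap.rTensor_tmul, LinearMap.comp_apply,
          LinearEquiv.coe_coe]
        generalize ρ.coact v = y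
        induction y with
        | zero => simp
        | add a b ha hb => simpa [TensorProduct.add_tmul, TensorProduct.tmul_add] using
            congr($ha + $hb)
        | tmul v g => simp [TensorProduct.smul_tmul']
    rw [h3, h4, h2]
  counit_coact := by
    apply LinearMap.ext
    intro φ
    apply (dualTensorHom_bijective (R := k) (M := V) (N := k)).1
    have h1 := congr($(dualTensorHom_comp_lTensor (R := k) (M := V)
      (counit (R := k) (A := H))) (ρ.dualCoact φ))
    simp only [LinearMap.comp_apply, dualTensorHom_dualCoact] at h1 ⊢
    rw [h1]
    ext v
    have h2 := congr($(ρ.counit_coact) v)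
    simp only [LinearMap.comp_apply, LinearEquiv.coe_coe, LinearMap.compRight_apply] at h2 ⊢
    have h3 : ∀ z : V ⊗[k] H, counit (R := k) (TensorProduct.lid k H
        (TensorProduct.map φ (antipode k) z)) =
        φ (TensorProduct.rid k V ((counit (R := k) (A := H)).lTensor V z)) := by
      intro z
      induction z with
      | zero => simp
      | add a b ha hb => simp [ha, hb]
      | tmul v g => simp [mul_comm]
    rw [h3, h2]
    simp

/-- For a linear functional `I` on `H`, the bilinear operation `H × V → V`,
`h ∘ v = v₀ I(h S(v₁))`. -/
noncomputable def circ (I : H →ₗ[k] k) (ρ : RightComodule k H V) : H →ₗ[k] V →ₗ[k] V :=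
  LinearMap.mk₂ k
    (fun h v ↦ TensorProduct.rid k V
      ((I ∘ₗ LinearMap.mulLeft k h ∘ₗ antipode k).lTensor V (ρ.coact v)))
    (fun h h' v ↦ by
      have : LinearMap.mulLeft k (h + h') = LinearMap.mulLeft k h + LinearMap.mulLeft k h' := by
        ext; simp [add_mul]
      simp [this, LinearMap.add_comp, LinearMap.comp_add])
    (fun c h v ↦ by
      have : LinearMap.mulLeft k (c • h) = c • LinearMap.mulLeft k h := by ext; simp
      simp [this, LinearMap.smul_comp, LinearMap.comp_smul])
    (by simp) (by simp)

/-- Given a bilinear operation `act : H × V → V`, the vector `b` generates `V`: every vector of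
`V` is of the form `act h b`. -/
def IsGenerator (act : H →ₗ[k] V →ₗ[k] V) (b : V) : Prop :=
  ∀ v : V, ∃ h : H, act h b = v

/-- Given a cyclic bilinear operation `act : H × V → V`, the coaction `σ` is the one given by
`v ↦ (act h₁ b) ⊗ h₂` for every generator `b` of `V` and every `h` with `act h b = v`. -/
def IsHat (act : H →ₗ[k] V →ₗ[k] V) (σ : RightComodule k H V) : Prop :=
  (∃ b, IsGenerator act b) ∧
    ∀ b, IsGenerator act b → ∀ h : H, σ.coact (act h b) = (act.flip b).rTensor H (comul h)

/-- `σ` is the coaction of the comodule `V^•` attached to `(V, ρ)` and the integral `I`. The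
underlying space of `V^•` is `V`, and the coaction is `v ↦ b₀ I(h₁ S(b₁)) ⊗ h₂` whenever
`v = b₀ I(h S(b₁))` and `b` generates `V`. -/
def IsBullet (I : H →ₗ[k] k) (ρ σ : RightComodule k H V) : Prop :=
  IsHat (circ I ρ) σ

end Hopf

end RightComodule

section Integral

open Coalgebra

variable {k : Type u} {H : Type v} [Field k] [Ring H] [HopfAlgebra k H]

/-- `I` is a left integral: a nonzero functional with `a₁ I(a₂) = I(a) 1`. -/
def IsLeftIntegral (I : H →ₗ[k] k) : Prop :=
  I ≠ 0 ∧ ∀ a : H, TensorProduct.rid k H (I.lTensor H (comul a)) = I a • (1 : H)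

/-- `I` is a right integral: a nonzero functional with `I(a₁) a₂ = I(a) 1`. -/
def IsRightIntegral (I : H →ₗ[k] k) : Prop :=
  I ≠ 0 ∧ ∀ a : H, TensorProduct.lid k H (I.rTensor H (comul a)) = I a • (1 : H)

variable (k H)

/-- `H` is coquasitriangular: there is a bilinear form `r` on `H`, invertible for the convolution
product on functionals on `H ⊗ H`, such that `r(ab, c) = r(a, c₁) r(b, c₂)`,
`r(a, bc) = r(a₁, c) r(a₂, b)` and `r(a₁, b₁) a₂ b₂ = b₁ a₁ r(a₂, b₂)`. In the last identity both
sides are convolution products of linear maps `H ⊗ H → H`. -/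
def IsCoquasitriangular : Prop :=
  ∃ r : H →ₗ[k] H →ₗ[k] k,
    IsUnit (WithConv.toConv (TensorProduct.lift r)) ∧
    (∀ a b c : H, r (a * b) c = LinearMap.mul' k k (TensorProduct.map (r a) (r b) (comul c))) ∧
    (∀ a b c : H, r a (b * c) =
      LinearMap.mul' k k (TensorProduct.map (r.flip c) (r.flip b) (comul a))) ∧
    WithConv.toConv (Algebra.linearMap k H ∘ₗ TensorProduct.lift r) *
        WithConv.toConv (LinearMap.mul' k H) =
      WithConv.toConv (LinearMap.mul' k H ∘ₗ (TensorProduct.comm k H H).toLinearMap) *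
        WithConv.toConv (Algebra.linearMap k H ∘ₗ TensorProduct.lift r)

end Integral

/-! A right comodule is a module over the convolution algebra `H*` via f·v = v₀ f(v₁), and this
action detects morphisms and subcomodules (`isHom_iff`, `isSubcomodule_iff`). The proof works with
it throughout.

The left integral property says that g ↦ I(– S(g)) is an `H*`-linear map β : H → H*
(`isColinear_rightForm`). Hence any linear map F between comodules can be averaged to a morphism v ↦
β(v₁)·F(v₀). Averaging replaces the usual Maschke argument: a comodule is injective exactly when its
identity is an average (`IsInjective.isRelInjective`, `IsRelInjective.isInjective`), and a comodule
with simple socle embeds into a finite-dimensional subcomodule of H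
(`IsSimple.finiteDimensional_of_socle_eq`). Moreover β is injective, so S is injective.

Part 1. The right integral property gives I(h₁ S(g)) h₂ = I(h S(g₂)) S²(g₁). So h ↦ h∘b is a
morphism from H to V with its coaction twisted by S². It is nonzero for b ≠ 0 and its range is a
subcomodule of V, so every nonzero b generates V. Thus V^• is the twist of V, and evaluation
identifies the twist with V**.

Part 2. The functional q(h) = r(h₂, S(h₁)) satisfies q(h₁) h₂ = q(h₂) S²(h₁) and has a left
convolution inverse, so acting by q is an isomorphism from V to its twist. It also follows that I∘S²
≠ 0, so the second form I(S(S(x) g)) can be used for averaging. Transposing such an average on J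
gives an average on J* for the first form, so J* is injective. For the socle of J*, averaging yields
a nonzero morphism J → V^• ≅ V. Since J is not the sum of two proper subcomodules, each proper
subcomodule lies in the kernel of this morphism. Dually, the image of V* → J* lies in every nonzero
subcomodule of J*, so it is the socle. Two finite-dimensional hulls embed into each other, hence are
isomorphic. -/

section TensorSeparation

/-! ### Separating tensors by functionals -/

variable {k : Type u} [Field k] {V : Type*} [AddCommGroup V] [Module k V]
  {W : Type*} [AddCommGroup W] [Module k W] {H : Type*} [AddCommGroup H] [Module k H]

/-- Contraction of the second factor of a tensor with a linear functional. -/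
noncomputable def evalRight (V : Type*) [AddCommGroup V] [Module k V] :
    Module.Dual k H →ₗ[k] (V ⊗[k] H →ₗ[k] V) :=
  (LinearMap.llcomp k (V ⊗[k] H) (V ⊗[k] k) V (TensorProduct.rid k V).toLinearMap) ∘ₗ
    LinearMap.lTensorHom V

@[simp]
theorem evalRight_tmul (f : Module.Dual k H) (v : V) (h : H) :
    evalRight V f (v ⊗ₜ[k] h) = f h • v := by
  simp [evalRight]

theorem evalRight_apply (f : Module.Dual k H) (z : V ⊗[k] H) :
    evalRight V f z = TensorProduct.rid k V (f.lTensor V z) := rfl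

theorem eq_zero_of_evalRight {z : V ⊗[k] H}
    (h : ∀ f : Module.Dual k H, evalRight V f z = 0) : z = 0 := by
  classical
  let b := Module.Basis.ofVectorSpace k H
  apply (TensorProduct.equivFinsuppOfBasisRight (M := V) b).injective
  ext i
  rw [map_zero, Finsupp.zero_apply, ← h (b.coord i)]
  generalize z = z
  induction z with
  | zero => simp
  | add a b ha hb => simp [ha, hb]
  | tmul v g => rw [TensorProduct.equivFinsuppOfBasisRight_apply_tmul_apply]; simp

theorem ext_evalRight {z z' : V ⊗[k] H}
    (h : ∀ f : Module.Dual k H, evalRight V f z = evalRight V f z') : z = z' :=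
  sub_eq_zero.1 <| eq_zero_of_evalRight fun f ↦ by rw [map_sub, h, sub_self]

theorem evalRight_rTensor (f : Module.Dual k H) (g : V →ₗ[k] W) (z : V ⊗[k] H) :
    evalRight W f (g.rTensor H z) = g (evalRight V f z) := by
  induction z with
  | zero => simp
  | add a b ha hb => simp [ha, hb]
  | tmul v g => simp

theorem evalRight_lTensor {H' : Type*} [AddCommGroup H'] [Module k H']
    (f : Module.Dual k H') (g : H →ₗ[k] H') (z : V ⊗[k] H) :
    evalRight V f (g.lTensor V z) = evalRight V (f ∘ₗ g) z := by
  induction z with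
  | zero => simp
  | add a b ha hb => simp [ha, hb]
  | tmul v g => simp

/-- By exactness of – ⊗ H, membership means vanishing in (V/U) ⊗ H, which functionals on `H` detect.
-/
theorem mem_range_rTensor_subtype {U : Submodule k V} {z : V ⊗[k] H} :
    z ∈ LinearMap.range (U.subtype.rTensor H) ↔
      ∀ f : Module.Dual k H, evalRight V f z ∈ U := by
  have he := _root_.rTensor_exact H (LinearMap.exact_subtype_mkQ U) U.mkQ_surjective
  rw [← he.linearMap_ker_eq, LinearMap.mem_ker]
  constructor
  · intro h f
    rw [← Submodule.Quotient.mk_eq_zero, ← Submodule.mkQ_apply, ← evalRight_rTensor, h,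
      map_zero]
  · intro h
    refine eq_zero_of_evalRight fun f ↦ ?_
    rw [evalRight_rTensor, Submodule.mkQ_apply, Submodule.Quotient.mk_eq_zero]
    exact h f

end TensorSeparation

/-! ### Comodules as modules over the dual algebra -/

namespace RightComodule

section Coalgebra

open Coalgebra

variable {k : Type u} {H : Type v} [Field k] [AddCommGroup H] [Module k H] [Coalgebra k H]
  {V : Type w} [AddCommGroup V] [Module k V] {W : Type x} [AddCommGroup W] [Module k W]
  {Z : Type y} [AddCommGroup Z] [Module k Z]

/-- The action `f · v = v₀ f(v₁)` of functionals on a right comodule. -/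
noncomputable def act (ρ : RightComodule k H V) : Module.Dual k H →ₗ[k] (V →ₗ[k] V) :=
  (LinearMap.lcomp k V ρ.coact) ∘ₗ evalRight V

theorem act_apply (ρ : RightComodule k H V) (f : Module.Dual k H) (v : V) :
    ρ.act f v = evalRight V f (ρ.coact v) := rfl

variable (k H) in
/-- The coalgebra as a right comodule over itself. -/
@[simps]
noncomputable def regular : RightComodule k H H where
  coact := comul
  coassoc := Coalgebra.coassoc
  counit_coact := Coalgebra.lTensor_counit_comp_comul

theorem act_counit (ρ : RightComodule k H V) (v : V) : ρ.act counit v = v := by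
  have := congr($(ρ.counit_coact) v)
  simp only [LinearMap.comp_apply] at this
  rw [act_apply, evalRight_apply, this]
  simp

theorem coact_injective (ρ : RightComodule k H V) : Function.Injective ρ.coact := by
  rw [← LinearMap.ker_eq_bot, LinearMap.ker_eq_bot']
  intro v hv
  rw [← ρ.act_counit v, act_apply, hv, map_zero]

theorem coact_act (ρ : RightComodule k H V) (f : Module.Dual k H) (v : V) :
    ρ.coact (ρ.act f v) = ((regular k H).act f).lTensor V (ρ.coact v) := by
  have h := congr($(ρ.coassoc) v)
  simp only [LinearMap.comp_apply, LinearEquiv.coe_coe] at h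
  have h1 : ∀ z : V ⊗[k] H, ρ.coact (evalRight V f z) =
      ((evalRight H f).lTensor V) (TensorProduct.assoc k V H H (ρ.coact.rTensor H z)) := by
    intro z
    induction z with
    | zero => simp
    | add a b ha hb => simp [ha, hb]
    | tmul v g =>
      simp only [evalRight_tmul, map_smul, LinearMap.rTensor_tmul]
      generalize ρ.coact v = y
      induction y with
      | zero => simp
      | add a b ha hb => simp [ha, hb, TensorProduct.add_tmul]
      | tmul v' g' => simp
  rw [act_apply, h1, h, ← LinearMap.comp_apply, ← LinearMap.lTensor_comp]
  rfl

/-- The functional on the right is the convolution product h ↦ f(h₁) g(h₂), so this is the module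
axiom. -/
theorem act_act (ρ : RightComodule k H V) (f g : Module.Dual k H) (v : V) :
    ρ.act f (ρ.act g v) = ρ.act (f ∘ₗ (regular k H).act g) v := by
  rw [act_apply, coact_act, evalRight_lTensor, act_apply]

/-- Through this identity a morphism into `H` is determined by its composite with the counit. -/
theorem counit_act_regular (f : Module.Dual k H) (h : H) :
    counit (R := k) ((regular k H).act f h) = f h := by
  have := congr($(Coalgebra.rTensor_counit_comp_comul (R := k) (A := H)) h)
  simp only [LinearMap.comp_apply] at this
  have h2 : ∀ z : H ⊗[k] H, counit (R := k) (evalRight H f z) =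
      f (TensorProduct.lid k H (counit.rTensor H z)) := by
    intro z
    induction z with
    | zero => simp
    | add a b ha hb => simp [ha, hb]
    | tmul v g => simp [mul_comm]
  rw [act_apply, h2, regular_coact, this]
  simp

theorem isHom_iff {ρ : RightComodule k H V} {σ : RightComodule k H W} {φ : V →ₗ[k] W} :
    IsHom ρ σ φ ↔ ∀ f v, φ (ρ.act f v) = σ.act f (φ v) := by
  constructor
  · intro h f v
    have := congr($h v)
    simp only [LinearMap.comp_apply] at this
    rw [act_apply, act_apply, this, evalRight_rTensor]
  · intro h
    ext v
    apply ext_evalRight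
    intro f
    simp only [LinearMap.comp_apply]
    rw [evalRight_rTensor, ← act_apply, ← act_apply, h]

theorem isSubcomodule_iff {ρ : RightComodule k H V} {U : Submodule k V} :
    ρ.IsSubcomodule U ↔ ∀ f, ∀ v ∈ U, ρ.act f v ∈ U := by
  simp only [IsSubcomodule, mem_range_rTensor_subtype]
  exact ⟨fun h f v hv ↦ h v hv f, fun h v hv f ↦ h f v hv⟩

theorem IsHom.comp {ρ : RightComodule k H V} {σ : RightComodule k H W} {τ : RightComodule k H Z}
    {ψ : W →ₗ[k] Z} {φ : V →ₗ[k] W} (hψ : IsHom σ τ ψ) (hφ : IsHom ρ σ φ) :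
    IsHom ρ τ (ψ ∘ₗ φ) := by
  rw [isHom_iff] at *
  intro f v
  simp [hφ, hψ]

theorem IsHom.symm {ρ : RightComodule k H V} {σ : RightComodule k H W} {e : V ≃ₗ[k] W}
    (h : IsHom ρ σ e.toLinearMap) : IsHom σ ρ e.symm.toLinearMap := by
  rw [isHom_iff] at *
  intro f v
  apply e.injective
  simpa using (h f (e.symm v)).symm

theorem Iso.symm {ρ : RightComodule k H V} {σ : RightComodule k H W} (h : Iso ρ σ) : Iso σ ρ :=
  let ⟨e, he⟩ := h
  ⟨e.symm, he.symm⟩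

theorem IsHom.isSubcomodule_map {ρ : RightComodule k H V} {σ : RightComodule k H W}
    {φ : V →ₗ[k] W} (h : IsHom ρ σ φ) {U : Submodule k V} (hU : ρ.IsSubcomodule U) :
    σ.IsSubcomodule (U.map φ) := by
  rw [isSubcomodule_iff] at *
  rw [isHom_iff] at h
  rintro f _ ⟨v, hv, rfl⟩
  exact ⟨_, hU f v hv, h f v⟩

theorem IsHom.isSubcomodule_comap {ρ : RightComodule k H V} {σ : RightComodule k H W}
    {φ : V →ₗ[k] W} (h : IsHom ρ σ φ) {U : Submodule k W} (hU : σ.IsSubcomodule U) :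
    ρ.IsSubcomodule (U.comap φ) := by
  rw [isSubcomodule_iff] at *
  rw [isHom_iff] at h
  intro f v hv
  rw [Submodule.mem_comap, h]
  exact hU f _ hv

theorem isSubcomodule_top (ρ : RightComodule k H V) : ρ.IsSubcomodule ⊤ :=
  isSubcomodule_iff.2 fun _ _ _ ↦ trivial

theorem isSubcomodule_bot (ρ : RightComodule k H V) : ρ.IsSubcomodule ⊥ :=
  isSubcomodule_iff.2 fun f v hv ↦ by simp_all

theorem IsHom.isSubcomodule_ker {ρ : RightComodule k H V} {σ : RightComodule k H W}
    {φ : V →ₗ[k] W} (h : IsHom ρ σ φ) : ρ.IsSubcomodule (LinearMap.ker φ) :=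
  h.isSubcomodule_comap σ.isSubcomodule_bot

theorem IsHom.isSubcomodule_range {ρ : RightComodule k H V} {σ : RightComodule k H W}
    {φ : V →ₗ[k] W} (h : IsHom ρ σ φ) : σ.IsSubcomodule (LinearMap.range φ) := by
  rw [LinearMap.range_eq_map]
  exact h.isSubcomodule_map ρ.isSubcomodule_top

/-- Transport of a comodule structure along a linear equivalence. -/
@[simps]
noncomputable def transport (ρ : RightComodule k H V) (e : V ≃ₗ[k] W) : RightComodule k H W where
  coact := e.toLinearMap.rTensor H ∘ₗ ρ.coact ∘ₗ e.symm.toLinearMap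
  coassoc := by
    apply LinearMap.ext
    intro w
    have h := congr($(ρ.coassoc) (e.symm w))
    simp only [LinearMap.comp_apply, LinearEquiv.coe_coe] at h ⊢
    have h1 : ∀ z : V ⊗[k] H, (TensorProduct.assoc k W H H)
        ((e.toLinearMap.rTensor H ∘ₗ ρ.coact ∘ₗ e.symm.toLinearMap).rTensor H
          (e.toLinearMap.rTensor H z)) = e.toLinearMap.rTensor (H ⊗[k] H)
            (TensorProduct.assoc k V H H (ρ.coact.rTensor H z)) := by
      intro z
      induction z with
      | zero => simp
      | add a b ha hb => simp only [map_add, ha, hb]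
      | tmul v g =>
        simp only [LinearMap.rTensor_tmul, LinearMap.comp_apply, LinearEquiv.coe_coe,
          LinearEquiv.symm_apply_apply]
        generalize ρ.coact v = y
        induction y with
        | zero => simp
        | add a b ha hb => simp only [map_add, ha, hb, TensorProduct.add_tmul]
        | tmul v' g' => simp
    rw [h1, h, ← LinearMap.comp_apply, LinearMap.rTensor_comp_lTensor,
      ← LinearMap.lTensor_comp_rTensor, LinearMap.comp_apply]
  counit_coact := by
    apply LinearMap.ext
    intro w
    have h := congr($(ρ.counit_coact) (e.symm w))
    simp only [LinearMap.comp_apply, LinearEquiv.coe_coe] at h ⊢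
    rw [← LinearMap.comp_apply, LinearMap.lTensor_comp_rTensor, ← LinearMap.rTensor_comp_lTensor,
      LinearMap.comp_apply, h]
    simp

theorem isHom_transport (ρ : RightComodule k H V) (e : V ≃ₗ[k] W) :
    IsHom ρ (ρ.transport e) e.toLinearMap := by
  ext v
  simp [transport]

/-- The cofree comodule `V ⊗ H`. -/
@[simps]
noncomputable def cofree (V : Type w) [AddCommGroup V] [Module k V] :
    RightComodule k H (V ⊗[k] H) where
  coact := (TensorProduct.assoc k V H H).symm.toLinearMap ∘ₗ (comul (R := k)).lTensor V
  coassoc := by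
    apply TensorProduct.ext'
    intro v h
    have hc := Coalgebra.coassoc_apply (R := k) h
    simp only [LinearMap.comp_apply, LinearEquiv.coe_coe, LinearMap.lTensor_tmul]
    have h1 : ∀ z : H ⊗[k] H, (TensorProduct.assoc k (V ⊗[k] H) H H)
        (LinearMap.rTensor H ((TensorProduct.assoc k V H H).symm.toLinearMap ∘ₗ
          (comul (R := k)).lTensor V) ((TensorProduct.assoc k V H H).symm (v ⊗ₜ[k] z))) =
        (TensorProduct.assoc k V H (H ⊗[k] H)).symm
          (v ⊗ₜ (TensorProduct.assoc k H H H (comul.rTensor H z))) := by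
      intro z
      induction z with
      | zero => simp
      | add a b ha hb => simp only [map_add, ha, hb, TensorProduct.tmul_add]
      | tmul a b =>
        simp only [LinearMap.rTensor_tmul, LinearMap.comp_apply, LinearEquiv.coe_coe,
          TensorProduct.assoc_symm_tmul, LinearMap.lTensor_tmul]
        generalize comul (R := k) a = y
        induction y with
        | zero => simp
        | add a b ha hb => simp only [map_add, ha, hb, TensorProduct.tmul_add,
            TensorProduct.add_tmul]
        | tmul v' g' => simp
    rw [h1, hc]
    generalize comul (R := k) h = y
    induction y with
    | zero => simp
    | add a b ha hb => simp only [map_add, ha, hb, TensorProduct.tmul_add]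
    | tmul v' g' =>
      simp only [LinearMap.lTensor_tmul, TensorProduct.assoc_symm_tmul]
  counit_coact := by
    apply TensorProduct.ext'
    intro v h
    have hc := Coalgebra.lTensor_counit_comul (R := k) h
    simp only [LinearMap.comp_apply, LinearEquiv.coe_coe, LinearMap.lTensor_tmul]
    have h1 : ∀ z : H ⊗[k] H, (counit (R := k)).lTensor (V ⊗[k] H)
        ((TensorProduct.assoc k V H H).symm (v ⊗ₜ[k] z)) =
        (TensorProduct.assoc k V H k).symm (v ⊗ₜ ((counit (R := k)).lTensor H z)) := by
      intro z
      induction z with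
      | zero => simp
      | add a b ha hb => simp only [map_add, ha, hb, TensorProduct.tmul_add]
      | tmul a b => simp
    rw [h1, hc]
    simp

theorem act_cofree_tmul (f : Module.Dual k H) (z : V) (h : H) :
    (cofree V : RightComodule k H (V ⊗[k] H)).act f (z ⊗ₜ h) = z ⊗ₜ (regular k H).act f h := by
  rw [act_apply, act_apply, cofree_coact, regular_coact, LinearMap.comp_apply,
    LinearMap.lTensor_tmul]
  generalize comul (R := k) h = y
  induction y with
  | zero => simp
  | add a b ha hb => simp_all [TensorProduct.tmul_add]
  | tmul v' g' => simp

theorem isHom_coact (ρ : RightComodule k H V) : IsHom ρ (cofree V) ρ.coact := by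
  rw [IsHom, cofree_coact, LinearMap.comp_assoc, ← ρ.coassoc]
  ext v
  simp

end Coalgebra

end RightComodule

/-! ### Averaging linear maps, and injectivity -/

namespace RightComodule

section Averaging

open Coalgebra

universe z

variable {k : Type u} {H : Type v} [Field k] [AddCommGroup H] [Module k H] [Coalgebra k H]
  {V : Type w} [AddCommGroup V] [Module k V] {W : Type x} [AddCommGroup W] [Module k W]
  {X : Type y} [AddCommGroup X] [Module k X] {Y : Type z} [AddCommGroup Y] [Module k Y]

/-- A bilinear form on `H` is colinear if it is, as a map `H → H*`, compatible with the action of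
functionals on `H` and the convolution product of functionals. -/
def IsColinear (β : H →ₗ[k] H →ₗ[k] k) : Prop :=
  ∀ f g, β ((regular k H).act f g) = f ∘ₗ (regular k H).act (β g)

/-- The average `v ↦ β(v₁) · F(v₀)` of a linear map `F` between comodules. -/
noncomputable def avg (β : H →ₗ[k] H →ₗ[k] k) (ρ : RightComodule k H V) (σ : RightComodule k H W)
    (F : V →ₗ[k] W) : V →ₗ[k] W :=
  TensorProduct.lift ((σ.act ∘ₗ β).flip ∘ₗ F) ∘ₗ ρ.coact

variable {β : H →ₗ[k] H →ₗ[k] k} {ρ : RightComodule k H V} {σ : RightComodule k H W}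
  {ξ : RightComodule k H X}

theorem isHom_avg (hβ : IsColinear β) (F : V →ₗ[k] W) : IsHom ρ σ (avg β ρ σ F) := by
  rw [isHom_iff]
  intro f v
  simp only [avg, LinearMap.comp_apply, coact_act]
  generalize ρ.coact v = z
  induction z with
  | zero => simp
  | add a b ha hb => simp only [map_add, ha, hb]
  | tmul v g => simp [hβ f g, act_act]

theorem avg_add (F G : V →ₗ[k] W) : avg β ρ σ (F + G) = avg β ρ σ F + avg β ρ σ G := by
  ext v
  simp only [avg, LinearMap.comp_apply, LinearMap.add_apply]
  generalize ρ.coact v = z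
  induction z with
  | zero => simp
  | add a b ha hb => simp only [map_add, ha, hb]; abel
  | tmul v g => simp

theorem IsHom.avg_comp {φ : X →ₗ[k] V} (hφ : IsHom ξ ρ φ) (F : V →ₗ[k] W) :
    avg β ξ σ (F ∘ₗ φ) = avg β ρ σ F ∘ₗ φ := by
  ext v
  have h := congr($hφ v)
  simp only [LinearMap.comp_apply] at h
  simp only [avg, LinearMap.comp_apply, h]
  generalize ξ.coact v = z
  induction z with
  | zero => simp
  | add a b ha hb => simp only [map_add, ha, hb]
  | tmul v g => simp

theorem IsHom.comp_avg {φ : V →ₗ[k] W} (hφ : IsHom ρ σ φ) (F : X →ₗ[k] V) :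
    avg β ξ σ (φ ∘ₗ F) = φ ∘ₗ avg β ξ ρ F := by
  ext v
  rw [isHom_iff] at hφ
  simp only [avg, LinearMap.comp_apply]
  generalize ξ.coact v = z
  induction z with
  | zero => simp
  | add a b ha hb => simp only [map_add, ha, hb]
  | tmul v g => simp [hφ]

theorem avg_mem {M : Submodule k W} (hM : σ.IsSubcomodule M) {F : V →ₗ[k] W}
    (hF : ∀ v, F v ∈ M) (v : V) : avg β ρ σ F v ∈ M := by
  rw [isSubcomodule_iff] at hM
  simp only [avg, LinearMap.comp_apply]
  generalize ρ.coact v = z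
  induction z with
  | zero => simp
  | add a b ha hb => rw [map_add]; exact M.add_mem ha hb
  | tmul v g => exact hM _ _ (hF v)

/-- A colinear form is separating if the identity of `H` is an average: it suffices that
`β(h₂)(L h₁) = ε(h)` for some linear map `L`. -/
def IsSeparating (β : H →ₗ[k] H →ₗ[k] k) : Prop :=
  ∃ L : H →ₗ[k] H, ∀ h, TensorProduct.lift (β.flip ∘ₗ L) (comul h) = counit (R := k) h

/-- The average is an endomorphism of the comodule `H`, and the hypothesis on `L` says that it
preserves the counit; this forces it to be the identity. -/
theorem avg_regular_eq_id (hβ : IsColinear β) {L : H →ₗ[k] H}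
    (hL : ∀ h, TensorProduct.lift (β.flip ∘ₗ L) (comul h) = counit (R := k) h) :
    avg β (regular k H) (regular k H) L = LinearMap.id := by
  have h1 : ∀ h, counit (R := k) (avg β (regular k H) (regular k H) L h) = counit (R := k) h := by
    intro h
    refine Eq.trans ?_ (hL h)
    simp only [avg, LinearMap.comp_apply, regular_coact]
    generalize comul (R := k) h = z
    induction z with
    | zero => simp
    | add a b ha hb => simp only [map_add, ha, hb]
    | tmul v g => simp [counit_act_regular]
  ext h
  rw [← sub_eq_zero, ← Module.forall_dual_apply_eq_zero_iff k]
  intro f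
  rw [map_sub, sub_eq_zero, ← counit_act_regular f, ← isHom_iff.1 (isHom_avg hβ L), h1,
    counit_act_regular]
  rfl

theorem avg_cofree_eq_id (hβ : IsColinear β) {L : H →ₗ[k] H}
    (hL : ∀ h, TensorProduct.lift (β.flip ∘ₗ L) (comul h) = counit (R := k) h) :
    avg β (cofree V) (cofree V) (L.lTensor V) = LinearMap.id := by
  apply TensorProduct.ext'
  intro v h
  have h1 := congr(v ⊗ₜ[k] $(avg_regular_eq_id hβ hL) h)
  rw [LinearMap.id_apply] at h1 ⊢
  refine Eq.trans ?_ h1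
  simp only [avg, LinearMap.comp_apply, regular_coact, cofree_coact, LinearMap.lTensor_tmul]
  generalize comul (R := k) h = z
  induction z with
  | zero => simp
  | add a b ha hb => simp only [map_add, ha, hb, TensorProduct.tmul_add]
  | tmul v g => simp [act_cofree_tmul]

/-- The identity of a comodule is an average. -/
def IsRelInjective (β : H →ₗ[k] H →ₗ[k] k) (ρ : RightComodule k H V) : Prop :=
  ∃ F : V →ₗ[k] V, avg β ρ ρ F = LinearMap.id

/-- The coaction embeds V into the cofree comodule V ⊗ H, whose identity is an average; injectivity
provides a retraction, and averages are stable under composition with morphisms on either side. -/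
theorem IsInjective.isRelInjective (hβ : IsColinear β) (hβ' : IsSeparating β)
    (h : ρ.IsInjective) : ρ.IsRelInjective β := by
  obtain ⟨L, hL⟩ := hβ'
  -- Test objects must live in the universe fixed by `IsInjective`, so both comodules are lifted to
  -- it.
  let e : V ≃ₗ[k] ULift.{max u v} V := ULift.moduleEquiv.symm
  let e' : (V ⊗[k] H) ≃ₗ[k] ULift.{u} (V ⊗[k] H) := ULift.moduleEquiv.symm
  have he := isHom_transport ρ e
  have he' := isHom_transport (cofree V : RightComodule k H _) e'
  obtain ⟨g, hg, hgf⟩ := h (ULift.{max u v} V) (ULift.{u} (V ⊗[k] H)) (ρ.transport e)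
    ((cofree V).transport e') (e'.toLinearMap ∘ₗ ρ.coact ∘ₗ e.symm.toLinearMap) e.symm.toLinearMap
    (he'.comp (ρ.isHom_coact.comp he.symm))
    (e'.injective.comp (ρ.coact_injective.comp e.symm.injective)) he.symm
  refine ⟨(g ∘ₗ e'.toLinearMap) ∘ₗ L.lTensor V ∘ₗ ρ.coact, ?_⟩
  rw [(hg.comp he').comp_avg, ρ.isHom_coact.avg_comp, avg_cofree_eq_id hβ hL]
  ext v
  have := congr($hgf (e v))
  simpa using this

/-- If r is a linear retraction of i, the average of F ∘ f ∘ r extends f. The universes of the test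
comodules are arbitrary here, so hulls in different universes can be compared. -/
theorem IsRelInjective.exists_extension (hβ : IsColinear β) (h : ρ.IsRelInjective β)
    {ξ : RightComodule k H X} {η : RightComodule k H Y} {i : X →ₗ[k] Y} {f : X →ₗ[k] V}
    (hi : IsHom ξ η i) (hinj : Function.Injective i) (hf : IsHom ξ ρ f) :
    ∃ g : Y →ₗ[k] V, IsHom η ρ g ∧ g ∘ₗ i = f := by
  obtain ⟨F, hF⟩ := h
  obtain ⟨r, hr⟩ := i.exists_leftInverse_of_injective (LinearMap.ker_eq_bot.2 hinj)
  refine ⟨avg β η ρ (F ∘ₗ f ∘ₗ r), isHom_avg hβ _, ?_⟩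
  rw [← hi.avg_comp, LinearMap.comp_assoc, LinearMap.comp_assoc, hr, LinearMap.comp_id,
    hf.avg_comp, hF, LinearMap.id_comp]

theorem IsRelInjective.isInjective (hβ : IsColinear β) (h : ρ.IsRelInjective β) :
    ρ.IsInjective :=
  fun _ _ _ _ _ _ _ _ _ _ hi hinj hf ↦ h.exists_extension hβ hi hinj hf

end Averaging

/-! ### Finiteness and socles -/

section Socle

open Coalgebra

variable {k : Type u} {H : Type v} [Field k] [AddCommGroup H] [Module k H] [Coalgebra k H]
  {V : Type w} [AddCommGroup V] [Module k V] {W : Type x} [AddCommGroup W] [Module k W]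
  {ρ : RightComodule k H V} {σ : RightComodule k H W}

/-- The subcomodule generated by a vector. -/
noncomputable def cyclic (ρ : RightComodule k H V) (v : V) : Submodule k V :=
  LinearMap.range (ρ.act.flip v)

theorem mem_cyclic (ρ : RightComodule k H V) (v : V) : v ∈ ρ.cyclic v :=
  ⟨counit, by simp [act_counit]⟩

theorem isSubcomodule_cyclic (ρ : RightComodule k H V) (v : V) :
    ρ.IsSubcomodule (ρ.cyclic v) := by
  rw [isSubcomodule_iff]
  rintro f _ ⟨g, rfl⟩
  exact ⟨_, (ρ.act_act f g v).symm⟩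

theorem IsSubcomodule.cyclic_le {U : Submodule k V} (hU : ρ.IsSubcomodule U) {v : V}
    (hv : v ∈ U) : ρ.cyclic v ≤ U := by
  rintro _ ⟨f, rfl⟩
  exact isSubcomodule_iff.1 hU f v hv

theorem finiteDimensional_cyclic (ρ : RightComodule k H V) (v : V) :
    FiniteDimensional k (ρ.cyclic v) := by
  classical
  obtain ⟨S, hS⟩ := TensorProduct.exists_finset (ρ.coact v)
  have h : ρ.cyclic v ≤ Submodule.span k ((S.image Prod.fst : Finset V) : Set V) := by
    rintro _ ⟨f, rfl⟩
    simp only [LinearMap.flip_apply, act_apply, hS, map_sum, evalRight_tmul]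
    exact Submodule.sum_mem _ fun i hi ↦ Submodule.smul_mem _ _
      (Submodule.subset_span (by simpa using ⟨i.2, hi⟩))
  exact Submodule.finiteDimensional_of_le h

/-- Every nonzero subcomodule contains a simple subcomodule. -/
theorem IsSubcomodule.exists_isSimpleSubcomodule_le {U : Submodule k V} (hU : ρ.IsSubcomodule U)
    (hne : U ≠ ⊥) : ∃ U' ≤ U, ρ.IsSimpleSubcomodule U' := by
  obtain ⟨v, hv, hv0⟩ := U.exists_mem_ne_zero_of_ne_bot hne
  have hfin := ρ.finiteDimensional_cyclic v
  have hsub := ρ.isSubcomodule_cyclic v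
  have hne' : ρ.cyclic v ≠ ⊥ := fun h ↦ hv0 (by simpa [h] using ρ.mem_cyclic v)
  suffices ∃ U' ≤ ρ.cyclic v, ρ.IsSimpleSubcomodule U' by
    obtain ⟨U', h1, h2⟩ := this
    exact ⟨U', h1.trans (hU.cyclic_le hv), h2⟩
  revert hfin hsub hne'
  generalize ρ.cyclic v = C
  intro _ hC hCne
  induction hn : Module.finrank k C using Nat.strong_induction_on generalizing C with
  | _ n ih =>
    by_cases h : ∀ U' ≤ C, ρ.IsSubcomodule U' → U' = ⊥ ∨ U' = C
    · exact ⟨C, le_rfl, hC, hCne, h⟩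
    · push Not at h
      obtain ⟨U', hle, hU', hne', hne''⟩ := h
      have : FiniteDimensional k U' := Submodule.finiteDimensional_of_le hle
      obtain ⟨U'', h1, h2⟩ := ih _ (hn ▸ Submodule.finrank_lt_finrank_of_lt
        (lt_of_le_of_ne hle hne'')) U' this hU' hne' rfl
      exact ⟨U'', h1.trans hle, h2⟩

theorem IsSimple.socle_eq_top (h : ρ.IsSimple) : ρ.socle = ⊤ := by
  have := h.1
  exact top_unique (le_sSup ⟨ρ.isSubcomodule_top, top_ne_bot, fun U _ hU ↦ h.2 U hU⟩)

theorem IsSimple.finiteDimensional (h : ρ.IsSimple) : FiniteDimensional k V := by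
  have := h.1
  obtain ⟨v, hv⟩ := exists_ne (0 : V)
  have hfin := ρ.finiteDimensional_cyclic v
  have h1 : ρ.cyclic v = ⊤ := (h.2 _ (ρ.isSubcomodule_cyclic v)).resolve_left
    fun h ↦ hv (by simpa [h] using ρ.mem_cyclic v)
  rw [h1] at hfin
  exact Module.finite_def.2 (Module.Finite.iff_fg.1 hfin)

/-- Essentiality of a simple socle: a nonzero subcomodule contains a simple one, which lies in the
socle and therefore fills it. -/
theorem IsHom.range_le {j : V →ₗ[k] W} (hj : IsHom ρ σ j) (hρ : ρ.IsSimple)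
    (hs : σ.socle = LinearMap.range j) {U : Submodule k W} (hU : σ.IsSubcomodule U)
    (hne : U ≠ ⊥) : LinearMap.range j ≤ U := by
  obtain ⟨U', hle, hU'⟩ := hU.exists_isSimpleSubcomodule_le hne
  refine le_trans ?_ hle
  rw [LinearMap.range_eq_map, Submodule.map_le_iff_le_comap, top_le_iff]
  refine (hρ.2 _ (hj.isSubcomodule_comap hU'.1)).resolve_left fun h ↦ hU'.2.1 ?_
  have h1 : U' ≤ LinearMap.range j := hs ▸ le_sSup hU'
  rw [← Submodule.map_comap_eq_of_le h1, h, Submodule.map_bot]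

theorem IsInjectiveHull.exists_range_eq_socle (hρ : ρ.IsSimple) (h : IsInjectiveHull ρ σ) :
    ∃ j : V →ₗ[k] W, IsHom ρ σ j ∧ Function.Injective j ∧ σ.socle = LinearMap.range j := by
  obtain ⟨-, j, hj, hb⟩ := h
  rw [hρ.socle_eq_top, Submodule.top_coe] at hb
  refine ⟨j, hj, Set.injOn_univ.1 hb.injOn, SetLike.coe_injective ?_⟩
  rw [← hb.image_eq, Set.image_univ, LinearMap.coe_range]

theorem IsHom.isSimple_of_range_le [Nontrivial V] {j : V →ₗ[k] W} (hj : IsHom ρ σ j)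
    (hinj : Function.Injective j)
    (h : ∀ U, σ.IsSubcomodule U → U ≠ ⊥ → LinearMap.range j ≤ U) : ρ.IsSimple := by
  refine ⟨inferInstance, fun U hU ↦ or_iff_not_imp_left.2 fun hne ↦ ?_⟩
  have h1 := h _ (hj.isSubcomodule_map hU) fun h ↦
    hne (Submodule.map_injective_of_injective hinj (h.trans (Submodule.map_bot j).symm))
  rw [LinearMap.range_eq_map, Submodule.map_le_map_iff_of_injective hinj] at h1
  exact top_unique h1

theorem IsHom.socle_eq_range [Nontrivial V] {j : V →ₗ[k] W} (hj : IsHom ρ σ j)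
    (hinj : Function.Injective j)
    (h : ∀ U, σ.IsSubcomodule U → U ≠ ⊥ → LinearMap.range j ≤ U) :
    σ.socle = LinearMap.range j := by
  have hne : LinearMap.range j ≠ ⊥ := by
    rw [Ne, LinearMap.range_eq_bot]
    rintro rfl
    obtain ⟨v, hv⟩ := exists_ne (0 : V)
    exact hv (hinj (by simp))
  apply le_antisymm
  · refine sSup_le fun U hU ↦ ?_
    have h1 := h U hU.1 hU.2.1
    exact ((hU.2.2 _ h1 hj.isSubcomodule_range).resolve_left hne).ge
  · refine le_sSup ⟨hj.isSubcomodule_range, hne, fun U hle hU ↦ or_iff_not_imp_left.2 fun hU0 ↦ ?_⟩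
    exact le_antisymm hle (h U hU hU0)

end Socle

end RightComodule

/-! ### Cancelling the antipode by convolution -/

section HopfConvolution

open Coalgebra HopfAlgebra WithConv LinearMap

variable {k : Type u} {H : Type v} [Field k] [Ring H] [HopfAlgebra k H]

/-- If `X(g₁) S(g₂) = y(g)`, then `X(g) = y(g₁) g₂`. -/
theorem eq_of_mul_antipode_eq {X Y : H →ₗ[k] H}
    (h : mul' k H ∘ₗ TensorProduct.map X (antipode k) ∘ₗ comul = Y) :
    X = mul' k H ∘ₗ TensorProduct.map Y LinearMap.id ∘ₗ comul := by
  have h1 : toConv X * toConv (antipode k) = toConv Y := by rw [LinearMap.convMul_def, ← h]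
  have h2 : toConv X = toConv Y * toConv LinearMap.id := by
    rw [← h1, mul_assoc, antipode_mul_id, mul_one]
  rw [LinearMap.convMul_def] at h2
  exact toConv_injective h2

/-- If `S(g₁) X(g₂) = y(g)`, then `X(g) = g₁ y(g₂)`. -/
theorem eq_of_antipode_mul_eq {X Y : H →ₗ[k] H}
    (h : mul' k H ∘ₗ TensorProduct.map (antipode k) X ∘ₗ comul = Y) :
    X = mul' k H ∘ₗ TensorProduct.map LinearMap.id Y ∘ₗ comul := by
  have h1 : toConv (antipode k) * toConv X = toConv Y := by rw [LinearMap.convMul_def, ← h]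
  have h2 : toConv X = toConv LinearMap.id * toConv Y := by
    rw [← h1, ← mul_assoc, id_mul_antipode, one_mul]
  rw [LinearMap.convMul_def] at h2
  exact toConv_injective h2

/-- If `X(g₂) S(g₁) = y(g)`, then `X(g) = y(g₂) S²(g₁)`. -/
theorem eq_of_op_antipode_mul_eq {X Y : H →ₗ[k] H}
    (h : mul' k H ∘ₗ (TensorProduct.comm k H H).toLinearMap ∘ₗ
      TensorProduct.map (antipode k) X ∘ₗ comul = Y) :
    X = mul' k H ∘ₗ (TensorProduct.comm k H H).toLinearMap ∘ₗ
      TensorProduct.map (antipode k ∘ₗ antipode k) Y ∘ₗ comul := by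
  -- In maps to the opposite algebra the reversed product becomes a convolution product, and S² is a
  -- left inverse of S there because S(h₂) S²(h₁) = S(S(h₁) h₂).
  let o : H →ₗ[k] Hᵐᵒᵖ := (MulOpposite.opLinearEquiv k).toLinearMap
  have ho : Function.Injective o := (MulOpposite.opLinearEquiv k).injective
  have hmul : ∀ A B : H →ₗ[k] H, toConv (o ∘ₗ A) * toConv (o ∘ₗ B) =
      toConv (o ∘ₗ mul' k H ∘ₗ (TensorProduct.comm k H H).toLinearMap ∘ₗ
      TensorProduct.map A B ∘ₗ comul) := by
    intro A B
    rw [LinearMap.convMul_def]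
    congr 1
    ext g
    simp only [comp_apply]
    generalize comul (R := k) g = z
    induction z with
    | zero => simp
    | add a b ha hb => simp only [map_add, ha, hb]
    | tmul a b => simp [o]
  have h1 : toConv (o ∘ₗ antipode k) * toConv (o ∘ₗ X) = toConv (o ∘ₗ Y) := by rw [hmul, h]
  have h2 : toConv (o ∘ₗ antipode k ∘ₗ antipode k) * toConv (o ∘ₗ antipode k) = 1 := by
    rw [hmul]
    apply WithConv.ext
    rw [LinearMap.convOne_def]
    ext g
    have hg := congr(antipode k $(mul_antipode_rTensor_comul_apply (R := k) g))
    have : ∀ z : H ⊗[k] H, mul' k H ((TensorProduct.comm k H H)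
        (TensorProduct.map (antipode k ∘ₗ antipode k) (antipode k) z)) =
        antipode k (mul' k H ((antipode k).rTensor H z)) := by
      intro z
      induction z with
      | zero => simp
      | add a b ha hb => simp only [map_add, ha, hb]
      | tmul a b => simp [antipode_mul_antidistrib]
    simp only [comp_apply, LinearEquiv.coe_coe, this, hg]
    simp [o, Algebra.algebraMap_eq_smul_one]
  have h3 : toConv (o ∘ₗ X) = toConv (o ∘ₗ antipode k ∘ₗ antipode k) * toConv (o ∘ₗ Y) := by
    rw [← h1, ← mul_assoc, h2, one_mul]
  rw [hmul] at h3
  have h4 := toConv_injective h3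
  ext g
  exact ho congr($h4 g)

end HopfConvolution

/-! ### The bilinear forms attached to an integral -/

section Integral

open Coalgebra HopfAlgebra RightComodule LinearMap

variable {k : Type u} {H : Type v} [Field k] [Ring H] [HopfAlgebra k H] {I : H →ₗ[k] k}

/-- The bilinear form `(g, x) ↦ I(x S(g))`. -/
noncomputable def rightForm (I : H →ₗ[k] k) : H →ₗ[k] H →ₗ[k] k :=
  ((LinearMap.mul k H).compr₂ I).flip ∘ₗ antipode k

/-- The bilinear form `(g, x) ↦ I(S(x) g)`. -/
noncomputable def leftForm (I : H →ₗ[k] k) : H →ₗ[k] H →ₗ[k] k :=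
  (((LinearMap.mul k H).compr₂ I) ∘ₗ antipode k).flip

@[simp]
theorem rightForm_apply (g x : H) : rightForm I g x = I (x * antipode k g) := rfl

@[simp]
theorem leftForm_apply (g x : H) : leftForm I g x = I (antipode k x * g) := rfl

theorem map_act_regular (f g : Module.Dual k H) (h : H) :
    f ((regular k H).act g h) = mul' k k (TensorProduct.map f g (comul h)) := by
  rw [act_apply, regular_coact]
  generalize comul (R := k) h = z
  induction z with
  | zero => simp
  | add a b ha hb => simp only [map_add, ha, hb]
  | tmul a b => simp [mul_comm]

theorem isRightIntegral_of_act (h0 : I ≠ 0)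
    (h : ∀ (f : Module.Dual k H) (a : H), I ((regular k H).act f a) = f 1 * I a) :
    IsRightIntegral I := by
  refine ⟨h0, fun a ↦ ?_⟩
  rw [← sub_eq_zero, ← Module.forall_dual_apply_eq_zero_iff k]
  intro f
  rw [map_sub, sub_eq_zero, map_smul, smul_eq_mul, mul_comm, ← h, map_act_regular]
  generalize comul (R := k) a = z
  induction z with
  | zero => simp
  | add a b ha hb => simp only [map_add, ha, hb]
  | tmul a b => simp

theorem comul_antipode (g : H) : comul (R := k) (antipode k g) =
    TensorProduct.map (antipode k) (antipode k) (TensorProduct.comm k H H (comul g)) :=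
  congr($(comul_comp_antipode_eq (k := k) (H := H)) g)

/-- `x₁ I(x₂ S(g)) = I(x S(g₁)) g₂`. -/
theorem isColinear_rightForm (hl : IsLeftIntegral I) : IsColinear (rightForm I) := by
  intro f g
  ext x
  let X : H →ₗ[k] H := ((regular k H).act ∘ₗ rightForm I).flip x
  have hX : mul' k H ∘ₗ TensorProduct.map X (antipode k) ∘ₗ comul =
      ((rightForm I).flip x).smulRight (1 : H) := by
    ext g
    -- This reads x₁ S(g₂) I(x₂ S(g₁)) = I(x S(g)) 1, that is, X(g₁) S(g₂) = I(x S(g)) 1 for X(g) =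
    -- x₁ I(x₂ S(g)).
    have h := hl.2 (x * antipode k g)
    rw [Bialgebra.comul_mul, comul_antipode] at h
    simp only [smulRight_apply, flip_apply, rightForm_apply]
    rw [← h]
    simp only [comp_apply, X]
    generalize comul (R := k) g = t
    have h2 : ∀ c, ((regular k H).act ∘ₗ rightForm I).flip x c =
      evalRight H (rightForm I c) (comul x) := fun c ↦ rfl
    induction t with
    | zero => simp
    | add a b ha hb => simp only [map_add, ha, hb, mul_add]
    | tmul c d =>
      simp only [TensorProduct.map_tmul, TensorProduct.comm_tmul, h2, mul'_apply]
      generalize comul (R := k) x = z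
      induction z with
      | zero => simp
      | add a b ha hb => simp only [map_add, ha, hb, add_mul]
      | tmul a b => simp
  have h := congr(f ($(eq_of_mul_antipode_eq hX) g))
  refine Eq.trans ?_ h.symm
  simp only [comp_apply]
  change ((rightForm I).flip x) _ = _
  rw [map_act_regular]
  generalize comul (R := k) g = z
  induction z with
  | zero => simp
  | add a b ha hb => simp only [map_add, ha, hb]
  | tmul a b => simp

/-- `I(S(x) g₁) g₂ = x₁ I(S(x₂) g)`. -/
theorem isColinear_leftForm (hr : IsRightIntegral I) : IsColinear (leftForm I) := by
  intro f g
  ext x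
  let E : H ⊗[k] H →ₗ[k] H →ₗ[k] H :=
    TensorProduct.lift (smulRightₗ ∘ₗ leftForm I)
  have hE : ∀ a b x, E (a ⊗ₜ b) x = leftForm I a x • b := fun a b x ↦ by simp [E]
  have hX : mul' k H ∘ₗ TensorProduct.map (antipode k) (E (comul g)) ∘ₗ comul =
      ((leftForm I) g).smulRight (1 : H) := by
    ext x
    have h := hr.2 (antipode k x * g)
    rw [Bialgebra.comul_mul, comul_antipode] at h
    simp only [smulRight_apply, leftForm_apply]
    rw [← h]
    simp only [comp_apply]
    generalize comul (R := k) x = t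
    induction t with
    | zero => simp
    | add a b ha hb => simp only [map_add, ha, hb, add_mul]
    | tmul c d =>
      simp only [TensorProduct.map_tmul, TensorProduct.comm_tmul, mul'_apply]
      generalize comul (R := k) g = z
      induction z with
      | zero => simp
      | add a b ha hb => simp only [map_add, LinearMap.add_apply, ha, hb, mul_add]
      | tmul a b => simp [hE]
  have h := congr(f ($(eq_of_antipode_mul_eq hX) x))
  have h1 : f (E (comul g) x) = leftForm I ((regular k H).act f g) x := by
    change _ = (leftForm I).flip x _
    rw [map_act_regular]
    generalize comul (R := k) g = z
    induction z with
    | zero => simp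
    | add a b ha hb => simp only [map_add, LinearMap.add_apply, ha, hb]
    | tmul a b => simp [hE]
  rw [← h1, h]
  refine Eq.trans ?_ (map_act_regular _ _ _).symm
  simp only [comp_apply]
  generalize comul (R := k) x = z
  induction z with
  | zero => simp
  | add a b ha hb => simp only [map_add, ha, hb]
  | tmul a b => simp [mul_comm]

/-- `I(h₁ S(g)) h₂ = I(h S(g₂)) S²(g₁)`. -/
theorem rightForm_flip_act (hr : IsRightIntegral I) (f : Module.Dual k H) (h : H) :
    (rightForm I).flip ((regular k H).act f h) =
      (f ∘ₗ antipode k ∘ₗ antipode k) ∘ₗ (regular k H).act ((rightForm I).flip h) := by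
  ext g
  let E : H ⊗[k] H →ₗ[k] H →ₗ[k] H :=
    TensorProduct.lift (smulRightₗ ∘ₗ (rightForm I).flip)
  have hE : ∀ a b x, E (a ⊗ₜ b) x = rightForm I x a • b := fun a b x ↦ by simp [E]
  have hX : mul' k H ∘ₗ (TensorProduct.comm k H H).toLinearMap ∘ₗ
      TensorProduct.map (antipode k) (E (comul h)) ∘ₗ comul =
      ((rightForm I).flip h).smulRight (1 : H) := by
    ext x
    have hI := hr.2 (h * antipode k x)
    rw [Bialgebra.comul_mul, comul_antipode] at hI
    simp only [smulRight_apply, rightForm_apply, flip_apply]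
    rw [← hI]
    simp only [comp_apply]
    generalize comul (R := k) x = t
    induction t with
    | zero => simp
    | add a b ha hb => simp only [map_add, ha, hb, mul_add]
    | tmul c d =>
      simp only [TensorProduct.map_tmul, TensorProduct.comm_tmul, mul'_apply, LinearEquiv.coe_coe]
      generalize comul (R := k) h = z
      induction z with
      | zero => simp
      | add a b ha hb => simp only [map_add, LinearMap.add_apply, ha, hb, add_mul]
      | tmul a b => simp [hE]
  have h0 := congr(f ($(eq_of_op_antipode_mul_eq hX) g))
  have h1 : f (E (comul h) g) = (rightForm I).flip ((regular k H).act f h) g := by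
    rw [flip_apply, map_act_regular]
    generalize comul (R := k) h = z
    induction z with
    | zero => simp
    | add a b ha hb => simp only [map_add, LinearMap.add_apply, ha, hb]
    | tmul a b => simp [hE]
  rw [← h1, h0]
  refine Eq.trans ?_ (map_act_regular (f ∘ₗ antipode k ∘ₗ antipode k) _ g).symm
  simp only [comp_apply]
  generalize comul (R := k) g = z
  induction z with
  | zero => simp
  | add a b ha hb => simp only [map_add, ha, hb]
  | tmul a b => simp [mul_comm]

/-- With I(t) = 1 one has I(t h₁ S(h₂)) = ε(h). -/
theorem isSeparating_rightForm (h0 : I ≠ 0) : IsSeparating (rightForm I) := by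
  obtain ⟨t, ht⟩ : ∃ t, I t = 1 := by
    obtain ⟨t, ht⟩ := DFunLike.ne_iff.1 h0
    exact ⟨(I t)⁻¹ • t, by simp at ht; simp [ht]⟩
  refine ⟨mulLeft k t, fun h ↦ ?_⟩
  have h1 := congr(I (t * $(mul_antipode_lTensor_comul_apply (R := k) h)))
  rw [Algebra.algebraMap_eq_smul_one, mul_smul_comm, mul_one, map_smul, ht, smul_eq_mul,
    mul_one] at h1
  rw [← h1]
  generalize comul (R := k) h = z
  induction z with
  | zero => simp
  | add a b ha hb => simp only [map_add, ha, hb, mul_add]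
  | tmul a b => simp [mul_assoc]

/-- With I(S(t)) = 1 one has I(S(h₁ t) h₂) = I(S(t) S(h₁) h₂) = ε(h). -/
theorem isSeparating_leftForm (h0 : I ∘ₗ antipode k ≠ 0) : IsSeparating (leftForm I) := by
  obtain ⟨t, ht⟩ : ∃ t, I (antipode k t) = 1 := by
    obtain ⟨t, ht⟩ := DFunLike.ne_iff.1 h0
    exact ⟨(I (antipode k t))⁻¹ • t, by simp at ht; simp [ht]⟩
  refine ⟨mulRight k t, fun h ↦ ?_⟩
  have h1 := congr(I (antipode k t * $(mul_antipode_rTensor_comul_apply (R := k) h)))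
  rw [Algebra.algebraMap_eq_smul_one, mul_smul_comm, mul_one, map_smul, ht, smul_eq_mul,
    mul_one] at h1
  rw [← h1]
  generalize comul (R := k) h = z
  induction z with
  | zero => simp
  | add a b ha hb => simp only [map_add, ha, hb, mul_add]
  | tmul a b => simp [mul_assoc, antipode_mul_antidistrib]

/-- `I ∘ S` is a right integral, unless it vanishes. -/
theorem isRightIntegral_comp_antipode (hl : IsLeftIntegral I) (h0 : I ∘ₗ antipode k ≠ 0) :
    IsRightIntegral (I ∘ₗ antipode k) := by
  refine isRightIntegral_of_act h0 fun f a ↦ ?_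
  -- Evaluated at x = 1, colinearity is already the right integral identity for I ∘ S.
  have h := congr($(isColinear_rightForm hl f a) 1)
  simp only [rightForm_apply, comp_apply, act_apply, regular_coact, Bialgebra.comul_one,
    Algebra.TensorProduct.one_def, evalRight_tmul, one_mul, map_smul, smul_eq_mul] at h
  rw [comp_apply, act_apply, regular_coact, h, comp_apply, mul_comm]

/-- The form `(g, x) ↦ I(x S(g))` is nondegenerate. -/
theorem rightForm_injective (hl : IsLeftIntegral I) : Function.Injective (rightForm I) := by
  -- The kernel is a subcomodule and a right ideal, so with g it contains g₁ S(g₂) = ε(g) 1. As 1 in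
  -- the kernel would give I = 0, the counit vanishes on the kernel, and then f(g) = ε(f·g) = 0 for
  -- all f.
  have hsub : (regular k H).IsSubcomodule (ker (rightForm I)) := by
    rw [isSubcomodule_iff]
    intro f g hg
    rw [mem_ker] at hg ⊢
    rw [isColinear_rightForm hl f g, hg, map_zero, comp_zero]
  have hmul : ∀ g ∈ ker (rightForm I), ∀ x, g * x ∈ ker (rightForm I) := by
    intro g hg x
    rw [mem_ker] at hg ⊢
    ext y
    simpa [antipode_mul_antidistrib, mul_assoc] using congr($hg (y * antipode k x))
  have hcounit : ∀ g ∈ ker (rightForm I), counit (R := k) g = 0 := by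
    intro g hg
    have h1 : algebraMap k H (counit g) ∈ ker (rightForm I) := by
      rw [← mul_antipode_lTensor_comul_apply]
      obtain ⟨z, hz⟩ := hsub g hg
      rw [regular_coact] at hz
      rw [← hz]
      generalize z = z
      induction z with
      | zero => simp
      | add a b ha hb => simp only [map_add]; exact add_mem ha hb
      | tmul a b => simpa using hmul a a.2 (antipode k b)
    by_contra hne
    apply hl.1
    ext x
    have h2 := congr($(mem_ker.1 h1) x)
    simpa [Algebra.algebraMap_eq_smul_one, hne] using h2
  rw [← ker_eq_bot, ker_eq_bot']
  intro g hg
  rw [← Module.forall_dual_apply_eq_zero_iff k]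
  intro f
  rw [← counit_act_regular]
  exact hcounit _ (isSubcomodule_iff.1 hsub f g hg)

theorem antipode_injective (hl : IsLeftIntegral I) : Function.Injective (antipode k (A := H)) := by
  have := rightForm_injective hl
  rw [rightForm, coe_comp] at this
  exact this.of_comp

end Integral

/-! ### Matrix coefficients -/

namespace RightComodule

section Coefficients

open Coalgebra

variable {k : Type u} {H : Type v} [Field k] [AddCommGroup H] [Module k H] [Coalgebra k H]
  {V : Type w} [AddCommGroup V] [Module k V]

/-- The matrix coefficient `φ(v₀) v₁`. -/
noncomputable def coeff (ρ : RightComodule k H V) (φ : Module.Dual k V) : V →ₗ[k] H :=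
  (TensorProduct.lid k H).toLinearMap ∘ₗ φ.rTensor H ∘ₗ ρ.coact

theorem apply_coeff (ρ : RightComodule k H V) (f : Module.Dual k H) (φ : Module.Dual k V)
    (v : V) : f (ρ.coeff φ v) = φ (ρ.act f v) := by
  simp only [coeff, act_apply, LinearMap.comp_apply]
  generalize ρ.coact v = z
  induction z with
  | zero => simp
  | add a b ha hb => simp only [map_add, ha, hb]
  | tmul a b => simp [mul_comm]

theorem isHom_coeff (ρ : RightComodule k H V) (φ : Module.Dual k V) :
    IsHom ρ (regular k H) (ρ.coeff φ) := by
  rw [isHom_iff]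
  intro f v
  rw [← sub_eq_zero, ← Module.forall_dual_apply_eq_zero_iff k]
  intro g
  rw [map_sub, sub_eq_zero, apply_coeff, act_act, ← apply_coeff]
  rfl

theorem eq_zero_of_coeff (ρ : RightComodule k H V) {v : V} (h : ∀ φ, ρ.coeff φ v = 0) :
    v = 0 := by
  rw [← Module.forall_dual_apply_eq_zero_iff k]
  intro φ
  rw [← ρ.act_counit v, ← apply_coeff, h, map_zero]

end Coefficients

/-! ### Twisting by S², the comodule V^•, and duals -/

section Bullet

open Coalgebra HopfAlgebra

variable {k : Type u} {H : Type v} [Field k] [Ring H] [HopfAlgebra k H] {I : H →ₗ[k] k}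
  {V : Type w} [AddCommGroup V] [Module k V] {W : Type x} [AddCommGroup W] [Module k W]

variable (k H) in
theorem comul_comp_antipode_sq :
    comul (R := k) ∘ₗ antipode k ∘ₗ antipode k =
      TensorProduct.map (antipode k ∘ₗ antipode k) (antipode k ∘ₗ antipode k) ∘ₗ
        comul (R := k) (A := H) := by
  ext h
  simp only [LinearMap.comp_apply, comul_antipode]
  generalize comul (R := k) h = z
  induction z with
  | zero => simp
  | add a b ha hb => simp only [map_add, ha, hb]
  | tmul a b => simp

/-- The comodule `V` with its coaction twisted by the square of the antipode. -/
@[simps]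
noncomputable def twist (ρ : RightComodule k H V) : RightComodule k H V where
  coact := (antipode k ∘ₗ antipode k).lTensor V ∘ₗ ρ.coact
  coassoc := by
    ext v
    have h := congr($(ρ.coassoc) v)
    simp only [LinearMap.comp_apply, LinearEquiv.coe_coe] at h ⊢
    rw [← LinearMap.lTensor_comp_apply V (comul (R := k)), comul_comp_antipode_sq,
      LinearMap.lTensor_comp_apply V (TensorProduct.map _ _), ← h]
    generalize ρ.coact v = z
    induction z with
    | zero => simp
    | add a b ha hb => simp only [map_add, ha, hb]
    | tmul a b =>
      simp only [LinearMap.lTensor_tmul, LinearMap.rTensor_tmul, LinearMap.comp_apply]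
      generalize ρ.coact a = z
      induction z with
      | zero => simp
      | add a b ha hb => simp only [map_add, ha, hb, TensorProduct.add_tmul]
      | tmul a b => simp
  counit_coact := by
    rw [← ρ.counit_coact, ← LinearMap.comp_assoc, ← LinearMap.lTensor_comp,
      ← LinearMap.comp_assoc, counit_comp_antipode, counit_comp_antipode]

theorem act_twist (ρ : RightComodule k H V) (f : Module.Dual k H) (v : V) :
    ρ.twist.act f v = ρ.act (f ∘ₗ antipode k ∘ₗ antipode k) v := by
  rw [act_apply, twist_coact, LinearMap.comp_apply, evalRight_lTensor, act_apply]

theorem circ_apply (ρ : RightComodule k H V) (h : H) (v : V) :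
    circ I ρ h v = ρ.act ((rightForm I).flip h) v := rfl

/-- Equivalently, h ↦ h∘v is a morphism from `H` to the twist; this is what makes the twist the
comodule V^•. -/
theorem act_twist_circ (hr : IsRightIntegral I) (ρ : RightComodule k H V) (f : Module.Dual k H)
    (h : H) (v : V) : ρ.twist.act f (circ I ρ h v) = circ I ρ ((regular k H).act f h) v := by
  rw [act_twist, circ_apply, circ_apply, act_act, rightForm_flip_act hr]

/-- If all h∘v vanished, every matrix coefficient of v would lie in the kernel of the nondegenerate
form. -/
theorem exists_circ_ne_zero (hl : IsLeftIntegral I) (ρ : RightComodule k H V) {v : V}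
    (hv : v ≠ 0) : ∃ h, circ I ρ h v ≠ 0 := by
  by_contra! h
  refine hv (ρ.eq_zero_of_coeff fun φ ↦ rightForm_injective hl ?_)
  ext x
  change (rightForm I).flip x _ = _
  rw [apply_coeff, ← circ_apply, h]
  simp

/-- The range is a subcomodule of the twist. Since S² is injective, every functional has the form g
∘ S², so the twisted action sees all of the original one. -/
theorem isSubcomodule_range_circ (hl : IsLeftIntegral I) (hr : IsRightIntegral I)
    (ρ : RightComodule k H V) (b : V) :
    ρ.IsSubcomodule (LinearMap.range ((circ I ρ).flip b)) := by
  rw [isSubcomodule_iff]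
  rintro f _ ⟨h, rfl⟩
  obtain ⟨r, hr'⟩ := (antipode k ∘ₗ antipode k (A := H)).exists_leftInverse_of_injective
    (LinearMap.ker_eq_bot.2 ((antipode_injective hl).comp (antipode_injective hl)))
  refine ⟨(regular k H).act (f ∘ₗ r) h, ?_⟩
  rw [LinearMap.flip_apply, LinearMap.flip_apply, ← act_twist_circ hr, act_twist,
    LinearMap.comp_assoc, hr', LinearMap.comp_id]

theorem IsSimple.isGenerator (hl : IsLeftIntegral I) (hr : IsRightIntegral I)
    {ρ : RightComodule k H V} (hρ : ρ.IsSimple) {b : V} (hb : b ≠ 0) :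
    IsGenerator (circ I ρ) b := by
  have h := (hρ.2 _ (isSubcomodule_range_circ hl hr ρ b)).resolve_left fun h0 ↦ by
    obtain ⟨h, hh⟩ := exists_circ_ne_zero hl ρ hb
    have : circ I ρ h b ∈ LinearMap.range ((circ I ρ).flip b) := ⟨h, rfl⟩
    rw [h0] at this
    exact hh this
  exact fun v ↦ LinearMap.range_eq_top.1 h v

theorem IsSimple.isBullet_twist (hl : IsLeftIntegral I) (hr : IsRightIntegral I)
    {ρ : RightComodule k H V} (hρ : ρ.IsSimple) : IsBullet I ρ ρ.twist := by
  have := hρ.1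
  obtain ⟨b, hb⟩ := exists_ne (0 : V)
  refine ⟨⟨b, hρ.isGenerator hl hr hb⟩, fun b _ h ↦ ext_evalRight fun f ↦ ?_⟩
  rw [← act_apply, act_twist_circ hr, evalRight_rTensor]
  rfl

theorem IsBullet.unique {ρ σ τ : RightComodule k H V} (hσ : IsBullet I ρ σ)
    (hτ : IsBullet I ρ τ) : σ = τ := by
  obtain ⟨b, hb⟩ := hσ.1
  ext v
  obtain ⟨h, rfl⟩ := hb v
  rw [hσ.2 b hb, hτ.2 b hb]

theorem act_dual (ρ : RightComodule k H V) [FiniteDimensional k V] (f : Module.Dual k H)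
    (φ : Module.Dual k V) (v : V) : ρ.dual.act f φ v = φ (ρ.act (f ∘ₗ antipode k) v) := by
  have h1 : ∀ z : Module.Dual k V ⊗[k] H, evalRight _ f z v = f (dualTensorHom k V H z v) := by
    intro z
    induction z with
    | zero => simp
    | add a b ha hb => simp only [map_add, LinearMap.add_apply, ha, hb]
    | tmul a b => simp [mul_comm]
  rw [act_apply]
  refine (h1 _).trans ?_
  rw [dual, dualTensorHom_dualCoact, act_apply]
  simp only [LinearMap.comp_apply]
  generalize ρ.coact v = z
  induction z with
  | zero => simp
  | add a b ha hb => simp only [map_add, ha, hb]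
  | tmul a b => simp [mul_comm]

theorem iso_twist_dual_dual (ρ : RightComodule k H V) [FiniteDimensional k V] :
    Iso ρ.twist ρ.dual.dual := by
  refine ⟨Module.evalEquiv k V, isHom_iff.2 fun f v ↦ ?_⟩
  ext φ
  rw [act_dual, act_twist]
  simp [act_dual, LinearMap.comp_assoc]

theorem IsHom.dualMap {ρ : RightComodule k H V} {σ : RightComodule k H W} [FiniteDimensional k V]
    [FiniteDimensional k W] {φ : V →ₗ[k] W} (h : IsHom ρ σ φ) :
    IsHom σ.dual ρ.dual φ.dualMap := by
  rw [isHom_iff] at *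
  intro f ψ
  ext v
  simp [act_dual, h]

end Bullet

end RightComodule

/-! ### The Drinfeld functional -/

section Coquasitriangular

open Coalgebra HopfAlgebra RightComodule LinearMap WithConv

variable {k : Type u} {H : Type v} [Field k]

section Coalgebra

variable [AddCommGroup H] [Module k H]

/-- The linear map `a ⊗ ((b ⊗ c) ⊗ d) ↦ (a ⊗ b) ⊗ (c ⊗ d)`. -/
noncomputable def regroup : H ⊗[k] ((H ⊗[k] H) ⊗[k] H) →ₗ[k] (H ⊗[k] H) ⊗[k] (H ⊗[k] H) :=
  (TensorProduct.assoc k H H (H ⊗[k] H)).symm.toLinearMap ∘ₗ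
    (TensorProduct.assoc k H H H).toLinearMap.lTensor H

@[simp]
theorem regroup_tmul (a b c d : H) :
    regroup (k := k) (a ⊗ₜ ((b ⊗ₜ c) ⊗ₜ d)) = (a ⊗ₜ b) ⊗ₜ (c ⊗ₜ d) := by
  simp [regroup]

variable [Coalgebra k H]

/-- Both sides are h₁ ⊗ h₂ ⊗ h₃ ⊗ h₄; the right side shows the middle pair as one coproduct, ready
to be contracted. -/
theorem map_comul_comul (h : H) : TensorProduct.map comul comul (comul (R := k) h) =
    regroup ((comul.rTensor H ∘ₗ comul).lTensor H (comul (R := k) h)) := by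
  have h1 : (TensorProduct.assoc k H H H).toLinearMap ∘ₗ comul.rTensor H ∘ₗ comul =
      comul.lTensor H ∘ₗ comul := Coalgebra.coassoc
  have h2 := Coalgebra.coassoc_symm_apply (R := k) h
  rw [regroup, LinearMap.comp_apply, ← LinearMap.comp_apply (LinearMap.lTensor H _),
    ← LinearMap.lTensor_comp, h1, LinearMap.lTensor_comp, LinearMap.comp_apply]
  have h3 : ∀ z : H ⊗[k] (H ⊗[k] H), (TensorProduct.assoc k H H (H ⊗[k] H)).symm
      ((comul.lTensor H).lTensor H z) =
      comul.lTensor (H ⊗[k] H) ((TensorProduct.assoc k H H H).symm z) := by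
    intro z
    induction z with
    | zero => simp
    | add a b ha hb => simp only [map_add, ha, hb]
    | tmul a b =>
      induction b with
      | zero => simp
      | add a b ha hb => simp only [map_add, ha, hb, TensorProduct.tmul_add]
      | tmul a b => simp
  rw [LinearEquiv.coe_coe, h3, h2, ← LinearMap.comp_apply (LinearMap.lTensor (H ⊗[k] H) _)]
  exact congr($(LinearMap.lTensor_comp_rTensor H (comul (R := k)) (comul (R := k))) (comul h)).symm

end Coalgebra

variable [Ring H] [HopfAlgebra k H] {r : H →ₗ[k] H →ₗ[k] k}

/-- The functional `h ↦ r(h₂, S(h₁))`. -/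
noncomputable def drinfeldFunctional (r : H →ₗ[k] H →ₗ[k] k) : H →ₗ[k] k :=
  TensorProduct.lift (r.flip ∘ₗ antipode k) ∘ₗ comul

/-- `q(h₁) h₂ = q(h₂) S²(h₁)` for the functional `q(h) = r(h₂, S(h₁))`. -/
theorem drinfeldFunctional_conj
    (hr : toConv (Algebra.linearMap k H ∘ₗ TensorProduct.lift r) * toConv (mul' k H) =
      toConv (mul' k H ∘ₗ (TensorProduct.comm k H H).toLinearMap) *
        toConv (Algebra.linearMap k H ∘ₗ TensorProduct.lift r)) :
    (TensorProduct.lid k H).toLinearMap ∘ₗ (drinfeldFunctional r).rTensor H ∘ₗ comul =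
      mul' k H ∘ₗ (TensorProduct.comm k H H).toLinearMap ∘ₗ
      TensorProduct.map (antipode k ∘ₗ antipode k)
        ((drinfeldFunctional r).smulRight (1 : H)) ∘ₗ comul := by
  apply eq_of_op_antipode_mul_eq
  ext g
  let c : H ⊗[k] H →ₗ[k] H ⊗[k] H :=
    (TensorProduct.comm k H H).toLinearMap ∘ₗ (antipode k).rTensor H
  let m : (H ⊗[k] H) ⊗[k] (H ⊗[k] H) →ₗ[k] (H ⊗[k] H) ⊗[k] (H ⊗[k] H) :=
    (TensorProduct.tensorTensorTensorComm k H H H H).toLinearMap ∘ₗ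
      (TensorProduct.comm k (H ⊗[k] H) (H ⊗[k] H)).toLinearMap ∘ₗ
      (TensorProduct.map (antipode k) (antipode k) ∘ₗ
        (TensorProduct.comm k H H).toLinearMap).rTensor (H ⊗[k] H)
  have hc : ∀ z : H ⊗[k] H, comul (R := k) (c z) = m (TensorProduct.map comul comul z) := by
    intro z
    induction z with
    | zero => simp
    | add a b ha hb => simp only [map_add, ha, hb]
    | tmul a b =>
      simp [c, m, comul_antipode, TensorProduct.comul_tmul]
      rfl
  -- The commutation relation at g₂ ⊗ S(g₁): the left side is q(g₂) g₃ S(g₁), and the right side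
  -- S(g₂) g₃ r(g₄, S(g₁)) collapses to q(g) 1.
  have h := congr($hr (c (comul g)))
  rw [LinearMap.convMul_def, LinearMap.convMul_def] at h
  simp only [LinearMap.comp_apply, hc, map_comul_comul] at h
  have h1 : ∀ z : H ⊗[k] H, mul' k H (TensorProduct.map
      (Algebra.linearMap k H ∘ₗ TensorProduct.lift r) (mul' k H)
      (m (regroup ((comul.rTensor H ∘ₗ comul).lTensor H z)))) =
      mul' k H (TensorProduct.comm k H H (TensorProduct.map (antipode k)
      ((TensorProduct.lid k H).toLinearMap ∘ₗ (drinfeldFunctional r).rTensor H ∘ₗ comul) z)) := by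
    intro z
    induction z with
    | zero => simp
    | add a b ha hb => simp only [map_add, ha, hb]
    | tmul a b =>
      simp only [LinearMap.lTensor_tmul, TensorProduct.map_tmul, LinearMap.comp_apply]
      generalize comul (R := k) b = z
      induction z with
      | zero => simp
      | add a b ha hb => simp only [map_add, ha, hb, TensorProduct.tmul_add]
      | tmul b d =>
        simp only [LinearMap.rTensor_tmul, drinfeldFunctional, LinearMap.comp_apply]
        generalize comul (R := k) b = z
        induction z with
        | zero => simp
        | add a b ha hb => simp only [map_add, ha, hb, TensorProduct.tmul_add,
            TensorProduct.add_tmul]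
        | tmul b c => simp [m, Algebra.algebraMap_eq_smul_one]
  have h2 : ∀ z : H ⊗[k] H, mul' k H (TensorProduct.map
      (mul' k H ∘ₗ (TensorProduct.comm k H H).toLinearMap)
      (Algebra.linearMap k H ∘ₗ TensorProduct.lift r)
      (m (regroup ((comul.rTensor H ∘ₗ comul).lTensor H z)))) =
      TensorProduct.lift (r.flip ∘ₗ antipode k) z • (1 : H) := by
    intro z
    induction z with
    | zero => simp
    | add a b ha hb => simp only [map_add, ha, hb, add_smul]
    | tmul a b =>
      have h3 := congr(TensorProduct.lid k H
        $(Coalgebra.rTensor_counit_comul (R := k) b))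
      have h4 : ∀ z : H ⊗[k] H, mul' k H (TensorProduct.map
          (mul' k H ∘ₗ (TensorProduct.comm k H H).toLinearMap)
          (Algebra.linearMap k H ∘ₗ TensorProduct.lift r)
          (m (regroup (a ⊗ₜ comul.rTensor H z)))) =
          r (TensorProduct.lid k H (counit.rTensor H z)) (antipode k a) • (1 : H) := by
        intro z
        induction z with
        | zero => simp
        | add a b ha hb => simp only [map_add, ha, hb, TensorProduct.tmul_add, add_smul,
            LinearMap.add_apply]
        | tmul b d =>
          have h5 := HopfAlgebra.mul_antipode_rTensor_comul_apply (R := k) b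
          rw [Algebra.algebraMap_eq_smul_one] at h5
          simp only [LinearMap.rTensor_tmul, TensorProduct.lid_tmul, map_smul,
            LinearMap.smul_apply, smul_eq_mul, mul_comm (counit (R := k) b)]
          rw [mul_smul, ← h5]
          generalize comul (R := k) b = z
          induction z with
          | zero => simp
          | add a b ha hb => simp only [map_add, ha, hb, TensorProduct.tmul_add,
              TensorProduct.add_tmul, smul_add]
          | tmul b c => simp [m, Algebra.algebraMap_eq_smul_one]
      refine (h4 (comul b)).trans ?_
      rw [h3]
      simp
  refine (h1 _).symm.trans (h.trans (h2 _))

/-- The functional r(–, 1) is a convolution idempotent with a right inverse, hence the unit. -/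
theorem coquasitriangular_apply_one (hu : IsUnit (toConv (TensorProduct.lift r)))
    (hr : ∀ a b c : H, r a (b * c) =
      mul' k k (TensorProduct.map (r.flip c) (r.flip b) (comul a))) (a : H) :
    r a 1 = counit (R := k) a := by
  obtain ⟨s, hs⟩ := hu.exists_right_inv
  have h1 : toConv (r.flip 1) * toConv (r.flip 1) = toConv (r.flip 1) := by
    rw [LinearMap.convMul_def]
    congr 1
    ext a
    simpa using (hr a 1 1).symm
  have h2 : toConv (r.flip 1) * toConv (s.ofConv ∘ₗ (TensorProduct.mk k H H).flip 1) = 1 := by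
    rw [LinearMap.convMul_def]
    apply WithConv.ext
    ext a
    have h := congr($hs (a ⊗ₜ 1))
    rw [LinearMap.convMul_def] at h
    simp only [LinearMap.comp_apply, TensorProduct.comul_tmul,
      Bialgebra.comul_one, Algebra.TensorProduct.one_def] at h ⊢
    refine Eq.trans ?_ (h.trans ?_)
    · generalize comul (R := k) a = z
      induction z with
      | zero => simp
      | add a b ha hb => simp only [map_add, ha, hb, TensorProduct.add_tmul]
      | tmul b c => simp
    · simp [LinearMap.convOne_def]
  have h3 : toConv (r.flip 1) = 1 := by
    rw [← mul_one (toConv (r.flip 1)), ← h2, ← mul_assoc, h1]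
  simpa [LinearMap.convOne_def] using congr($h3 a)

/-- The functional `q(h) = r(h₂, S(h₁))` has the left convolution inverse
`h ↦ r(S²(h₂), h₁)`. -/
theorem drinfeldFunctional_left_inv (hu : IsUnit (toConv (TensorProduct.lift r)))
    (hr : ∀ a b c : H, r a (b * c) =
      mul' k k (TensorProduct.map (r.flip c) (r.flip b) (comul a)))
    (hconj : (TensorProduct.lid k H).toLinearMap ∘ₗ (drinfeldFunctional r).rTensor H ∘ₗ comul =
      mul' k H ∘ₗ (TensorProduct.comm k H H).toLinearMap ∘ₗ
      TensorProduct.map (antipode k ∘ₗ antipode k)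
        ((drinfeldFunctional r).smulRight (1 : H)) ∘ₗ comul) :
    (TensorProduct.lift (r.flip.compl₂ (antipode k ∘ₗ antipode k)) ∘ₗ comul) ∘ₗ
      (regular k H).act (drinfeldFunctional r) = counit (R := k) := by
  set q := drinfeldFunctional r with hq
  let B : H →ₗ[k] H →ₗ[k] k := r.flip.compl₂ (antipode k ∘ₗ antipode k)
  -- `q̄(h₁) q(h₂) = r(q(h₂) h₃, h₁)`
  have h1 : ∀ h, TensorProduct.lift B (comul ((regular k H).act q h)) =
      TensorProduct.lift (r.flip.compl₂ ((TensorProduct.lid k H).toLinearMap ∘ₗ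
        q.rTensor H ∘ₗ comul)) (comul h) := by
    intro h
    have h2 := coact_act (regular k H) q h
    rw [regular_coact] at h2
    rw [h2, hconj]
    generalize comul (R := k) h = z
    induction z with
    | zero => simp
    | add a b ha hb => simp only [map_add, ha, hb]
    | tmul a b =>
      simp only [LinearMap.lTensor_tmul, TensorProduct.lift.tmul, LinearMap.compl₂_apply,
        LinearMap.comp_apply, B, act_apply, regular_coact, LinearMap.flip_apply]
      generalize comul (R := k) b = z
      induction z with
      | zero => simp
      | add a b ha hb => simp only [map_add, ha, hb, LinearMap.add_apply]
      | tmul b c => simp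
  -- On h₁ ⊗ h₂ ⊗ h₃ ⊗ h₄ this is r(h₃, S(h₂)) r(h₄, h₁) = r(h₃, h₁ S(h₂)), which collapses to r(h,
  -- 1).
  let Ψ : (H ⊗[k] H) ⊗[k] (H ⊗[k] H) →ₗ[k] k :=
    mul' k k ∘ₗ TensorProduct.map (TensorProduct.lift (r.flip ∘ₗ antipode k))
      (TensorProduct.lift r.flip) ∘ₗ
      (TensorProduct.tensorTensorTensorComm k H H H H).toLinearMap ∘ₗ
      (TensorProduct.comm k H H).toLinearMap.rTensor (H ⊗[k] H)
  have hΨ : ∀ a b c d, Ψ ((a ⊗ₜ b) ⊗ₜ (c ⊗ₜ d)) = r c (antipode k b) * r d a := fun _ _ _ _ ↦ by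
    simp [Ψ]
  have h3 : ∀ z, TensorProduct.lift (r.flip.compl₂ ((TensorProduct.lid k H).toLinearMap ∘ₗ
        q.rTensor H ∘ₗ comul)) z = Ψ (regroup ((comul.rTensor H ∘ₗ comul).lTensor H z)) := by
    intro z
    induction z with
    | zero => simp
    | add a b ha hb => simp only [map_add, ha, hb]
    | tmul a b =>
      simp only [LinearMap.lTensor_tmul, TensorProduct.lift.tmul, LinearMap.compl₂_apply,
        LinearMap.comp_apply, LinearMap.flip_apply]
      generalize comul (R := k) b = z
      induction z with
      | zero => simp
      | add a b ha hb => simp only [map_add, ha, hb, LinearMap.add_apply, TensorProduct.tmul_add]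
      | tmul b c =>
        simp only [LinearMap.rTensor_tmul, hq, drinfeldFunctional, LinearMap.comp_apply]
        generalize comul (R := k) b = z
        induction z with
        | zero => simp
        | add a b ha hb => simp only [map_add, ha, hb, LinearMap.add_apply, TensorProduct.tmul_add,
            TensorProduct.add_tmul]
        | tmul b d => simp [hΨ]
  have h4 : ∀ z, Ψ (TensorProduct.map comul comul z) =
      r (TensorProduct.lid k H (counit.rTensor H z)) 1 := by
    intro z
    induction z with
    | zero => simp
    | add a b ha hb => simp only [map_add, ha, hb, LinearMap.add_apply]
    | tmul a b =>
      have h5 := congr(r b $(HopfAlgebra.mul_antipode_lTensor_comul_apply (R := k) a))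
      rw [Algebra.algebraMap_eq_smul_one, map_smul] at h5
      simp only [TensorProduct.map_tmul, LinearMap.rTensor_tmul, TensorProduct.lid_tmul, map_smul,
        LinearMap.smul_apply]
      rw [← h5]
      generalize comul (R := k) a = z
      induction z with
      | zero => simp
      | add a b ha hb => simp only [map_add, ha, hb, TensorProduct.add_tmul]
      | tmul a c =>
        simp only [LinearMap.lTensor_tmul, mul'_apply, hr]
        generalize comul (R := k) b = z
        induction z with
        | zero => simp
        | add a b ha hb => simp only [map_add, ha, hb, TensorProduct.tmul_add]
        | tmul b d => simp [hΨ]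
  ext h
  simp only [LinearMap.comp_apply]
  refine (h1 h).trans ?_
  rw [h3, ← map_comul_comul, h4, Coalgebra.rTensor_counit_comul, coquasitriangular_apply_one hu hr]
  simp

/-- The square of the antipode of a coquasitriangular Hopf algebra is conjugation with a
functional `q`. -/
theorem IsCoquasitriangular.exists_conj (h : IsCoquasitriangular k H) :
    ∃ q q' : Module.Dual k H, q' ∘ₗ (regular k H).act q = counit (R := k) ∧
      ∀ f : Module.Dual k H, q ∘ₗ (regular k H).act f =
        (f ∘ₗ antipode k ∘ₗ antipode k) ∘ₗ (regular k H).act q := by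
  obtain ⟨r, hu, -, h2, h3⟩ := h
  have hconj := drinfeldFunctional_conj h3
  refine ⟨_, _, drinfeldFunctional_left_inv hu h2 hconj, fun f ↦ ?_⟩
  ext h
  have h4 := congr(f ($hconj h))
  simp only [LinearMap.comp_apply] at h4
  rw [LinearMap.comp_apply, map_act_regular]
  refine Eq.trans ?_ (h4.trans ?_)
  · generalize comul (R := k) h = z
    induction z with
    | zero => simp
    | add a b ha hb => simp only [map_add, ha, hb]
    | tmul a b => simp
  · refine Eq.trans ?_ (map_act_regular (f ∘ₗ antipode k ∘ₗ antipode k) _ h).symm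
    generalize comul (R := k) h = z
    induction z with
    | zero => simp
    | add a b ha hb => simp only [map_add, ha, hb]
    | tmul a b => simp [mul_comm]

/-- The conjugation identity is q * f = (f ∘ S²) * q, so f ∘ S² = 0 gives q * f = 0, and q cancels
on the left. -/
theorem IsCoquasitriangular.comp_antipode_sq_ne_zero (h : IsCoquasitriangular k H)
    {f : Module.Dual k H} (hf : f ≠ 0) : f ∘ₗ antipode k ∘ₗ antipode k ≠ 0 := by
  obtain ⟨q, q', hq, hconj⟩ := h.exists_conj
  intro h0
  apply hf
  ext h
  have h1 := hconj f
  rw [h0, zero_comp] at h1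
  rw [← counit_act_regular, ← hq, LinearMap.comp_apply, act_act, h1]
  simp

theorem IsCoquasitriangular.iso_twist (h : IsCoquasitriangular k H) {V : Type w} [AddCommGroup V]
    [Module k V] [FiniteDimensional k V] (ρ : RightComodule k H V) : Iso ρ ρ.twist := by
  obtain ⟨q, q', hq, hconj⟩ := h.exists_conj
  have hinj : Function.Injective (ρ.act q) := by
    refine Function.LeftInverse.injective (g := ρ.act q') fun v ↦ ?_
    rw [act_act, hq, act_counit]
  refine ⟨LinearEquiv.ofInjectiveEndo _ hinj, isHom_iff.2 fun f v ↦ ?_⟩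
  change ρ.act q _ = ρ.twist.act f (ρ.act q v)
  rw [act_act, hconj, act_twist, act_act]

end Coquasitriangular

/-! ### Injective comodules with simple socle -/

namespace RightComodule

open Coalgebra HopfAlgebra

variable {k : Type u} {H : Type v} [Field k]
  {V : Type w} [AddCommGroup V] [Module k V] {J : Type x} [AddCommGroup J] [Module k J]
  {J' : Type y} [AddCommGroup J'] [Module k J']

section Coalgebra

variable [AddCommGroup H] [Module k H] [Coalgebra k H] {β : H →ₗ[k] H →ₗ[k] k}
  {ρ : RightComodule k H V} {τ : RightComodule k H J} {τ' : RightComodule k H J'}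
  {j : V →ₗ[k] J} {j' : V →ₗ[k] J'}

theorem exists_apply_ne_zero_of_injective [Nontrivial V] (hinj : Function.Injective j) :
    ∃ v, j v ≠ 0 := by
  obtain ⟨v, hv⟩ := exists_ne (0 : V)
  exact ⟨v, fun h ↦ hv (hinj (h.trans (map_zero j).symm))⟩

theorem coact_eq_sum {ι : Type*} [Fintype ι] (ρ : RightComodule k H V) (b : Module.Basis ι k V)
    (v : V) : ρ.coact v = ∑ i, b i ⊗ₜ[k] ρ.coeff (b.coord i) v := by
  apply ext_evalRight
  intro f
  simp only [map_sum, evalRight_tmul, apply_coeff, ← act_apply]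
  exact (b.sum_repr _).symm

/-- A relatively injective finite-dimensional comodule with simple socle is not the sum of two
proper subcomodules. -/
theorem IsRelInjective.eq_top_or_eq_top [FiniteDimensional k J] (hβ : IsColinear β)
    (hτ : τ.IsRelInjective β) (hρ : ρ.IsSimple) (hj : IsHom ρ τ j) (hinj : Function.Injective j)
    (hs : τ.socle = LinearMap.range j) {M M' : Submodule k J} (hM : τ.IsSubcomodule M)
    (hM' : τ.IsSubcomodule M') (h : M ⊔ M' = ⊤) : M = ⊤ ∨ M' = ⊤ := by
  have := hρ.1
  obtain ⟨F, hF⟩ := hτ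
  obtain ⟨s, hs'⟩ := (M.subtype.coprod M'.subtype).exists_rightInverse_of_surjective
    (by rw [LinearMap.range_coprod, Submodule.range_subtype, Submodule.range_subtype, h])
  -- Averaging a linear splitting of J = M + M' writes the identity as a sum of two endomorphisms
  -- with images in M and M'. They cannot both kill the socle, so one is injective, hence surjective
  -- by finite dimension.
  let P : J →ₗ[k] J := M.subtype ∘ₗ LinearMap.fst k M M' ∘ₗ s
  let P' : J →ₗ[k] J := M'.subtype ∘ₗ LinearMap.snd k M M' ∘ₗ s
  have hP : P + P' = LinearMap.id := by
    rw [← hs']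
    ext v
    simp [P, P']
  have hadd : avg β τ τ (P ∘ₗ F) + avg β τ τ (P' ∘ₗ F) = LinearMap.id := by
    rw [← avg_add, ← LinearMap.add_comp, hP, LinearMap.id_comp, hF]
  have key : ∀ (N : Submodule k J) (G : J →ₗ[k] J), τ.IsSubcomodule N → (∀ v, G v ∈ N) →
      LinearMap.ker (avg β τ τ G) = ⊥ → N = ⊤ := by
    intro N G hN hG hker
    rw [eq_top_iff]
    intro v _
    obtain ⟨w, rfl⟩ := LinearMap.surjective_of_injective (LinearMap.ker_eq_bot.1 hker) v
    exact avg_mem hN hG w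
  by_cases h1 : LinearMap.ker (avg β τ τ (P ∘ₗ F)) = ⊥
  · exact .inl (key M _ hM (fun v ↦ Subtype.coe_prop _) h1)
  by_cases h2 : LinearMap.ker (avg β τ τ (P' ∘ₗ F)) = ⊥
  · exact .inr (key M' _ hM' (fun v ↦ Subtype.coe_prop _) h2)
  exfalso
  obtain ⟨v, hv⟩ := exists_apply_ne_zero_of_injective hinj
  have h3 := hj.range_le hρ hs (isHom_avg hβ _).isSubcomodule_ker h1 ⟨v, rfl⟩
  have h4 := hj.range_le hρ hs (isHom_avg hβ _).isSubcomodule_ker h2 ⟨v, rfl⟩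
  have h5 := congr($hadd (j v))
  rw [LinearMap.add_apply, LinearMap.mem_ker.1 h3, LinearMap.mem_ker.1 h4] at h5
  exact hv (by simpa using h5.symm)

theorem IsRelInjective.exists_injective_extension (hβ : IsColinear β) (hτ : τ.IsRelInjective β)
    (hρ : ρ.IsSimple) (hj : IsHom ρ τ j) (hinj : Function.Injective j)
    (hj' : IsHom ρ τ' j') (hinj' : Function.Injective j') (hs' : τ'.socle = LinearMap.range j') :
    ∃ g : J' →ₗ[k] J, IsHom τ' τ g ∧ Function.Injective g := by
  have := hρ.1
  obtain ⟨g, hg, hgj⟩ := hτ.exists_extension hβ hj' hinj' hj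
  refine ⟨g, hg, LinearMap.ker_eq_bot.1 (by_contra fun hne ↦ ?_)⟩
  obtain ⟨v, hv⟩ := exists_apply_ne_zero_of_injective hinj
  apply hv
  rw [← hgj]
  exact hj'.range_le hρ hs' hg.isSubcomodule_ker hne ⟨v, rfl⟩

theorem IsRelInjective.iso [FiniteDimensional k J] [FiniteDimensional k J'] (hβ : IsColinear β)
    (hτ : τ.IsRelInjective β) (hτ' : τ'.IsRelInjective β) (hρ : ρ.IsSimple) (hj : IsHom ρ τ j)
    (hinj : Function.Injective j) (hs : τ.socle = LinearMap.range j)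
    (hj' : IsHom ρ τ' j') (hinj' : Function.Injective j')
    (hs' : τ'.socle = LinearMap.range j') : Iso τ' τ := by
  obtain ⟨g, hg, hgi⟩ := hτ.exists_injective_extension hβ hρ hj hinj hj' hinj' hs'
  obtain ⟨g', -, hgi'⟩ := hτ'.exists_injective_extension hβ hρ hj' hinj' hj hinj hs
  exact ⟨LinearMap.linearEquivOfInjective g hgi (le_antisymm
    (LinearMap.finrank_le_finrank_of_injective hgi)
    (LinearMap.finrank_le_finrank_of_injective hgi')), hg⟩

end Coalgebra

section Hopf

variable [Ring H] [HopfAlgebra k H] {I : H →ₗ[k] k}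
  {ρ : RightComodule k H V} {τ : RightComodule k H J} {j : V →ₗ[k] J}

/-- Over a Hopf algebra with a left integral, comodules with simple socle are
finite-dimensional. -/
theorem IsSimple.finiteDimensional_of_socle_eq (hl : IsLeftIntegral I) (hρ : ρ.IsSimple)
    (hj : IsHom ρ τ j) (hinj : Function.Injective j) (hs : τ.socle = LinearMap.range j) :
    FiniteDimensional k J := by
  have := hρ.1
  obtain ⟨v, hv⟩ := exists_apply_ne_zero_of_injective hinj
  obtain ⟨h, hh⟩ := exists_circ_ne_zero hl τ hv
  obtain ⟨φ, hφ⟩ : ∃ φ : Module.Dual k J, φ (circ I τ h (j v)) ≠ 0 := by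
    by_contra! h0
    exact hh ((Module.forall_dual_apply_eq_zero_iff k _).1 h0)
  -- The average of m ↦ φ(m) h lands in the finite-dimensional subcomodule generated by h. By the
  -- choice of h and φ it does not kill the socle, so it is injective.
  let A := avg (rightForm I) τ (regular k H) (φ.smulRight h)
  have hA : ∀ m, counit (R := k) (A m) = φ (circ I τ h m) := by
    intro m
    rw [circ_apply, act_apply]
    simp only [A, avg, LinearMap.comp_apply]
    generalize τ.coact m = z
    induction z with
    | zero => simp
    | add a b ha hb => simp only [map_add, ha, hb]
    | tmul a b => simp [counit_act_regular, mul_comm]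
  have hker : LinearMap.ker A = ⊥ := by
    by_contra hne
    have h1 := hj.range_le hρ hs (isHom_avg (isColinear_rightForm hl) _).isSubcomodule_ker hne
      ⟨v, rfl⟩
    apply hφ
    rw [← hA, LinearMap.mem_ker.1 h1, map_zero]
  have hmem : ∀ m, A m ∈ (regular k H).cyclic h :=
    avg_mem ((regular k H).isSubcomodule_cyclic h) fun m ↦
      Submodule.smul_mem _ _ ((regular k H).mem_cyclic h)
  have := (regular k H).finiteDimensional_cyclic h
  refine FiniteDimensional.of_injective (A.codRestrict _ hmem) ?_
  rw [← LinearMap.ker_eq_bot, LinearMap.ker_codRestrict, hker]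

/-- Averaging the transpose of F on J* transposes the average of F, but with the form I(S(g) S²(x))
= I(S(S(x) g)); this explains the change of form. -/
theorem IsRelInjective.dual [FiniteDimensional k J]
    (h : τ.IsRelInjective (leftForm (I ∘ₗ antipode k))) :
    τ.dual.IsRelInjective (rightForm I) := by
  obtain ⟨F, hF⟩ := h
  refine ⟨F.dualMap, ?_⟩
  ext φ m
  have h1 : ∀ z : Module.Dual k J ⊗[k] H,
      TensorProduct.lift ((τ.dual.act ∘ₗ rightForm I).flip ∘ₗ F.dualMap) z m =
      I (LinearMap.mul' k H (TensorProduct.comm k H H (TensorProduct.map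
        (antipode k ∘ₗ dualTensorHom k J H z ∘ₗ F) (antipode k) (τ.coact m)))) := by
    intro z
    induction z with
    | zero => simp
    | add a b ha hb =>
      simp only [map_add, ha, hb, LinearMap.add_apply, LinearMap.add_comp, LinearMap.comp_add,
        TensorProduct.map_add_left]
    | tmul ψ g =>
      simp only [TensorProduct.lift.tmul, LinearMap.comp_apply, LinearMap.flip_apply]
      rw [act_dual, LinearMap.dualMap_apply, act_apply]
      generalize τ.coact m = y
      induction y with
      | zero => simp
      | add a b ha hb => simp only [map_add, ha, hb]
      | tmul a b => simp [mul_comm]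
  have h2 : φ (avg (leftForm (I ∘ₗ antipode k)) τ τ F m) = φ m := by rw [hF]; rfl
  rw [LinearMap.id_apply, ← h2, avg, avg, LinearMap.comp_apply, h1]
  rw [RightComodule.dual, dualTensorHom_dualCoact]
  simp only [LinearMap.comp_apply]
  generalize τ.coact m = y
  induction y with
  | zero => simp
  | add a b ha hb => simp only [map_add, ha, hb]
  | tmul a b =>
    simp only [TensorProduct.map_tmul, TensorProduct.comm_tmul, LinearMap.mul'_apply,
      LinearMap.comp_apply, TensorProduct.lift.tmul, LinearMap.flip_apply, act_apply,
      LinearEquiv.coe_coe]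
    generalize τ.coact (F a) = z
    induction z with
    | zero => simp
    | add a b ha hb => simp only [map_add, ha, hb, mul_add]
    | tmul c d => simp [antipode_mul_antidistrib, mul_comm]

/-- A relatively injective comodule with a nonzero morphism from `V` has a nonzero morphism
to `V^•`. -/
theorem IsRelInjective.exists_isHom_twist [FiniteDimensional k V] [Nontrivial V]
    (hr : IsRightIntegral I) (hτ : τ.IsRelInjective (rightForm I))
    (hj : IsHom ρ τ j) (hinj : Function.Injective j) :
    ∃ q : J →ₗ[k] V, IsHom τ ρ.twist q ∧ q ≠ 0 := by
  by_contra! hq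
  -- For fixed φ and b, sending x to (φ(x₀) x₁)∘b is a morphism from J to the twist, so it is
  -- assumed to vanish. Expanding φ(j(v)), with j an average of F ∘ j, gives only such terms.
  have h0 : ∀ φ b x, ρ.act ((rightForm I).flip (τ.coeff φ x)) b = 0 := by
    intro φ b x
    rw [← circ_apply]
    have h1 := hq ((circ I ρ).flip b ∘ₗ τ.coeff φ) ?_
    · exact congr($h1 x)
    · rw [isHom_iff]
      intro f x
      simp only [LinearMap.comp_apply, LinearMap.flip_apply]
      rw [act_twist_circ hr, ← isHom_iff.1 (τ.isHom_coeff φ)]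
  obtain ⟨F, hF⟩ := hτ
  obtain ⟨v, hv⟩ := exists_apply_ne_zero_of_injective hinj
  apply hv
  have h1 := congr($(hj.avg_comp (β := rightForm I) (σ := τ) F) v)
  rw [hF, LinearMap.comp_apply, LinearMap.id_apply] at h1
  rw [← h1, ← Module.forall_dual_apply_eq_zero_iff k]
  intro φ
  rw [avg, LinearMap.comp_apply, ρ.coact_eq_sum (Module.finBasis k V), map_sum, map_sum]
  refine Finset.sum_eq_zero fun i _ ↦ ?_
  rw [TensorProduct.lift.tmul, LinearMap.comp_apply, LinearMap.flip_apply, LinearMap.comp_apply,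
    ← apply_coeff]
  change (rightForm I).flip _ _ = _
  rw [apply_coeff, h0, map_zero]

theorem IsSubcomodule.dualCoannihilator (hl : IsLeftIntegral I) [FiniteDimensional k J]
    {U : Submodule k (Module.Dual k J)} (hU : τ.dual.IsSubcomodule U) :
    τ.IsSubcomodule U.dualCoannihilator := by
  rw [isSubcomodule_iff] at *
  intro f m hm
  rw [Submodule.mem_dualCoannihilator] at *
  intro φ hφ
  obtain ⟨r, hr⟩ := (antipode k (A := H)).exists_leftInverse_of_injective
    (LinearMap.ker_eq_bot.2 (antipode_injective hl))
  have h := hm _ (hU (f ∘ₗ r) φ hφ)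
  rwa [act_dual, LinearMap.comp_assoc, hr, LinearMap.comp_id] at h

/-- The image of `V*` under the transpose of a nonzero morphism `J → V` is contained in all nonzero
subcomodules of `J*`. -/
theorem IsRelInjective.range_dualMap_le [FiniteDimensional k J] (hl : IsLeftIntegral I)
    (hτ : τ.IsRelInjective (rightForm I)) (hρ : ρ.IsSimple) (hj : IsHom ρ τ j)
    (hinj : Function.Injective j) (hs : τ.socle = LinearMap.range j)
    {q : J →ₗ[k] V} (hq : IsHom τ ρ q) (hq0 : q ≠ 0) {U : Submodule k (Module.Dual k J)}
    (hU : τ.dual.IsSubcomodule U) (hU0 : U ≠ ⊥) : LinearMap.range q.dualMap ≤ U := by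
  have hM := hU.dualCoannihilator hl
  have hUM : U.dualCoannihilator.dualAnnihilator = U :=
    Subspace.dualCoannihilator_dualAnnihilator_eq
  have hle : U.dualCoannihilator ≤ LinearMap.ker q := by
    -- If the annihilator M of U were not inside ker q, simplicity of V would give M + ker q = J,
    -- although both summands are proper.
    rcases hρ.2 _ (hq.isSubcomodule_map hM) with h | h
    · rwa [LinearMap.le_ker_iff_map]
    · exfalso
      have h1 : U.dualCoannihilator ⊔ LinearMap.ker q = ⊤ := by
        rw [← Submodule.comap_map_eq, h, Submodule.comap_top]
      rcases hτ.eq_top_or_eq_top (isColinear_rightForm hl) hρ hj hinj hs hM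
        hq.isSubcomodule_ker h1 with h2 | h2
      · exact hU0 (by rw [← hUM, h2, Submodule.dualAnnihilator_top])
      · exact hq0 (LinearMap.ker_eq_top.1 h2)
  rintro _ ⟨ψ, rfl⟩
  rw [← hUM, Submodule.mem_dualAnnihilator]
  intro m hm
  rw [LinearMap.dualMap_apply, LinearMap.mem_ker.1 (hle hm), map_zero]

end Hopf

end RightComodule

/-! ### The main theorem -/

theorem proposition2p11 {k : Type u} {H : Type v} [Field k] [Ring H] [HopfAlgebra k H]
    (I : H →ₗ[k] k) (hl : IsLeftIntegral I) (hr : IsRightIntegral I)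
    {V : Type w} [AddCommGroup V] [Module k V] (ρ : RightComodule k H V) (hρ : ρ.IsSimple) :
    ∃ _ : FiniteDimensional k V,
      -- `V^•` is well defined
      (∃! σ : RightComodule k H V, RightComodule.IsBullet I ρ σ) ∧
      -- `V^• ≅ V**`
      (∀ σ : RightComodule k H V, RightComodule.IsBullet I ρ σ →
        RightComodule.Iso σ ρ.dual.dual) ∧
      (IsCoquasitriangular k H →
        -- `V^• ≅ V`
        (∀ σ : RightComodule k H V, RightComodule.IsBullet I ρ σ → RightComodule.Iso σ ρ) ∧
        -- every injective hull `J` of `V` is finite-dimensional, its dual is an injective hull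
        -- of `V*`, and every injective hull `J'` of `V*` is isomorphic to it
        (∀ {J : Type x} [AddCommGroup J] [Module k J] (τ : RightComodule k H J),
          RightComodule.IsInjectiveHull ρ τ →
          ∃ _ : FiniteDimensional k J,
            RightComodule.IsInjectiveHull ρ.dual τ.dual ∧
            ∀ {J' : Type y} [AddCommGroup J'] [Module k J'] (τ' : RightComodule k H J'),
              RightComodule.IsInjectiveHull ρ.dual τ' → RightComodule.Iso τ' τ.dual)) := by
  have hfin := hρ.finiteDimensional
  have := hρ.1
  have hbullet := hρ.isBullet_twist hl hr
  have heq : ∀ σ, RightComodule.IsBullet I ρ σ → σ = ρ.twist := fun σ hσ ↦ hσ.unique hbullet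
  refine ⟨hfin, ⟨ρ.twist, hbullet, heq⟩, fun σ hσ ↦ heq σ hσ ▸ ρ.iso_twist_dual_dual, fun hc ↦
    ⟨fun σ hσ ↦ heq σ hσ ▸ (hc.iso_twist ρ).symm, fun {J} _ _ τ hτ ↦ ?_⟩⟩
  have hβ := isColinear_rightForm hl
  have hsep := isSeparating_rightForm hl.1
  have h2 := hc.comp_antipode_sq_ne_zero hl.1
  have h1 : I ∘ₗ HopfAlgebra.antipode k ≠ 0 := fun h ↦ h2 (by
    rw [← LinearMap.comp_assoc, h, LinearMap.zero_comp])
  obtain ⟨j, hj, hinj, hs⟩ := hτ.exists_range_eq_socle hρ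
  have hJ := hρ.finiteDimensional_of_socle_eq hl hj hinj hs
  have hrel := hτ.1.isRelInjective hβ hsep
  -- Injectivity of J does not depend on the form, so it may be expressed with the one whose
  -- transpose is `rightForm I`.
  have hdual : τ.dual.IsRelInjective (rightForm I) :=
    (hτ.1.isRelInjective (isColinear_leftForm (isRightIntegral_comp_antipode hl h1))
      (isSeparating_leftForm h2)).dual
  obtain ⟨q₀, hq₀, hne₀⟩ := hrel.exists_isHom_twist hr hj hinj
  obtain ⟨e, he⟩ := (hc.iso_twist ρ).symm
  -- The transpose of this surjection J → V is the embedding V* → J* that exhibits the hull.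
  let q := e.toLinearMap ∘ₗ q₀
  have hq : RightComodule.IsHom τ ρ q := he.comp hq₀
  have hq0 : q ≠ 0 := fun h ↦ hne₀ (by
    ext v
    exact e.injective (by simpa [q] using congr($h v)))
  have hsurj : Function.Surjective q := LinearMap.range_eq_top.1 <|
    (hρ.2 _ hq.isSubcomodule_range).resolve_left fun h ↦ hq0 (LinearMap.range_eq_bot.1 h)
  have hqinj : Function.Injective q.dualMap := LinearMap.dualMap_injective_of_surjective hsurj
  have hess : ∀ U, τ.dual.IsSubcomodule U → U ≠ ⊥ → LinearMap.range q.dualMap ≤ U :=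
    fun U hU hU0 ↦ hrel.range_dualMap_le hl hρ hj hinj hs hq hq0 hU hU0
  have hsimple := hq.dualMap.isSimple_of_range_le hqinj hess
  have hsocle := hq.dualMap.socle_eq_range hqinj hess
  refine ⟨hJ, ⟨hdual.isInjective hβ, q.dualMap, hq.dualMap, ?_⟩, fun {J'} _ _ τ' hτ' ↦ ?_⟩
  · rw [hsimple.socle_eq_top, hsocle, Submodule.top_coe, LinearMap.coe_range]
    exact ⟨fun v _ ↦ ⟨v, rfl⟩, hqinj.injOn, fun _ ⟨v, hv⟩ ↦ ⟨v, trivial, hv⟩⟩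
  · obtain ⟨j', hj', hinj', hs'⟩ := hτ'.exists_range_eq_socle hsimple
    have hJ' := hsimple.finiteDimensional_of_socle_eq hl hj' hinj' hs'
    exact hdual.iso hβ (hτ'.1.isRelInjective hβ hsep) hsimple hq.dualMap hqinj hsocle hj' hinj' hs'
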